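/- Let $k$ be a field, $G$ a finite group and $V$ a finite dimensional representation of $G$ over $k$. Let $B=k[V]$ be the polynomial ring on a basis of $V$, graded with $V$ in degree $1$ and with the induced action of $G$, and let $R=B^G$. Let $I\subseteq B$ be the ideal generated by the homogeneous elements of $R$ of positive degree, and let $\tau_G(V)$ be the smallest positive integer $d$ such that $I_d=B_d$. Let $f_1,\dots,f_r$ be a minimal set of homogeneous generators of the $k$-algebra $R$, and let $S=k[x_1,\dots,x_r]$ be graded by $\deg x_j=\deg f_j$ and act on $R$ through $x_j\mapsto f_j$. For a graded module $M$ over $A=S$ or $A=B$ and $i\ge 0$, let $t_i^A(M)\in\mathbb Z\cup\{\pm\infty\}$ be the largest degree in which the graded module $\operatorname{Tor}_i^A(M,k)$ is not zero, where $k=A/A_+$ ($-\infty$ if it is zero, $+\infty$ if the degrees are unbounded). Suppose that $\operatorname{char} k$ does not divide $|G|$ or, more generally, that the inclusion $R\hookrightarrow B$ is split as a map of $R$-modules. Then, for every $i\ge 0$, $$t_i^S(R)\le (i+1)\tau_G(V)+i-1\le (i+1)|G|+i-1 .$$ If, furthermore, $t_1^B(I)\le\tau_G(V)$, then, for every $i\ge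 0$, $$t_i^S(R)\le (i+1)\tau_G(V)-1\le (i+1)|G|-1 .$$ -/

import Mathlib

universe u v w

noncomputable section

/-- The ideal `A₊` generated by the homogeneous elements of positive degree. -/
def positiveIdeal {k : Type u} {A : Type v} [Field k] [CommRing A] [Algebra k A]
    (𝒜 : ℕ → Submodule k A) : Ideal A :=
  Ideal.span {a | ∃ n, 0 < n ∧ a ∈ 𝒜 n}

/-- The degree `n` part of the graded free module with one basis element of degree `deg j`
for each `j`: the coefficient at `j` is homogeneous of degree `n - deg j`. -/
def freePiece {k : Type u} {A : Type v} {J : Type w} [Field k] [CommRing A] [Algebra k A]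
    (𝒜 : ℕ → Submodule k A) (deg : J → ℕ) (n : ℕ) : Set (J →₀ A) :=
  {x | ∀ j, x j ∈ if deg j ≤ n then 𝒜 (n - deg j) else (⊥ : Submodule k A)}

/-- A graded free resolution `⋯ → F₁ → F₀ → M → 0` of a graded module `M` over a graded
`k`-algebra `A`. The term `Fᵢ` is free on homogeneous basis elements indexed by `J i`, and all
the maps preserve degree. -/
structure GradedFreeResolution {k : Type u} {A : Type v} {M : Type w} [Field k] [CommRing A]
    [Algebra k A] [AddCommGroup M] [Module k M] [Module A M]
    (𝒜 : ℕ → Submodule k A) (ℳ : ℕ → Submodule k M) where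
  J : ℕ → Type (max v w)
  deg : (i : ℕ) → J i → ℕ
  d : (i : ℕ) → (J (i + 1) →₀ A) →ₗ[A] (J i →₀ A)
  ε : (J 0 →₀ A) →ₗ[A] M
  d_graded : ∀ i n, ∀ x ∈ freePiece 𝒜 (deg (i + 1)) n, d i x ∈ freePiece 𝒜 (deg i) n
  ε_graded : ∀ n, ∀ x ∈ freePiece 𝒜 (deg 0) n, ε x ∈ ℳ n
  ε_surjective : Function.Surjective ε
  exact_zero : Function.Exact (d 0) ε
  exact_succ : ∀ i, Function.Exact (d (i + 1)) (d i)

namespace GradedFreeResolution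

variable {k : Type u} {A : Type v} {M : Type w} [Field k] [CommRing A]
  [Algebra k A] [AddCommGroup M] [Module k M] [Module A M]
  {𝒜 : ℕ → Submodule k A} {ℳ : ℕ → Submodule k M}

/-- The elements of `Fᵢ` whose images in `F ⊗ A/A₊ = F/A₊F` are cycles; the complex is zero in
negative homological degrees. -/
def cycles (F : GradedFreeResolution 𝒜 ℳ) : (i : ℕ) → Submodule A (F.J i →₀ A)
  | 0 => ⊤
  | i + 1 => (positiveIdeal 𝒜 • (⊤ : Submodule A (F.J i →₀ A))).comap (F.d i)

/-- The elements of `Fᵢ` whose images in `F ⊗ A/A₊ = F/A₊F` are boundaries. -/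
def boundaries (F : GradedFreeResolution 𝒜 ℳ) (i : ℕ) : Submodule A (F.J i →₀ A) :=
  positiveIdeal 𝒜 • (⊤ : Submodule A (F.J i →₀ A)) ⊔ LinearMap.range (F.d i)

/-- `Tor_i(M, A/A₊)`, the `i`th homology of `F ⊗ A/A₊ = F/A₊F`: cycles modulo boundaries. -/
def Tor (F : GradedFreeResolution 𝒜 ℳ) (i : ℕ) :
    Submodule A ((F.J i →₀ A) ⧸ F.boundaries i) :=
  (F.cycles i).map (F.boundaries i).mkQ

/-- The internal degree `n` part of `Tor_i(M, A/A₊)`: the classes of the cycles that are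
homogeneous of degree `n`. -/
def torPiece (F : GradedFreeResolution 𝒜 ℳ) (i n : ℕ) : Set (F.Tor i) :=
  {c | ∃ z ∈ F.cycles i, z ∈ freePiece 𝒜 (F.deg i) n ∧ (F.boundaries i).mkQ z = c}

end GradedFreeResolution

/-- The end of a graded module: the largest degree in which it is not zero, `⊤` if the degrees
are not bounded and `⊥` if the module is zero. -/
def gradedEnd {T : Type w} [Zero T] (𝒯 : ℕ → Set T) : EReal :=
  ⨆ (n : ℕ) (_ : ∃ c ∈ 𝒯 n, c ≠ 0), (n : EReal)

/-- `t_i^A(M)`, the end of `Tor_i^A(M, k)` where `k = A/A₊`. All graded free resolutions of `M`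
give the same graded `Tor`, so the supremum is over equal values. -/
def torEnd {k : Type u} {A : Type v} {M : Type w} [Field k] [CommRing A]
    [Algebra k A] [AddCommGroup M] [Module k M] [Module A M]
    (𝒜 : ℕ → Submodule k A) (ℳ : ℕ → Submodule k M) (i : ℕ) : EReal :=
  ⨆ F : GradedFreeResolution 𝒜 ℳ, gradedEnd (F.torPiece i)

section Invariants

open MvPolynomial

variable {k : Type u} [Field k] {G : Type v} [Group G]
  {V : Type w} [AddCommGroup V] [Module k V] {ι : Type} [Fintype ι]

/-- The action of `g` on `k[V]`, the polynomial ring on a basis `b` of `V`, by the `k`-algebra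
endomorphism that extends the action of `g` on the span `V` of the variables. -/
def polyAction (b : Module.Basis ι k V) (ρ : Representation k G V) (g : G) :
    MvPolynomial ι k →ₐ[k] MvPolynomial ι k :=
  aeval fun i => ∑ j, C (b.repr (ρ g (b i)) j) * X j

/-- The ring of invariants `R = k[V]^G`. -/
def invariantRing (b : Module.Basis ι k V) (ρ : Representation k G V) :
    Subalgebra k (MvPolynomial ι k) :=
  ⨅ g : G, AlgHom.equalizer (polyAction b ρ g) (AlgHom.id k (MvPolynomial ι k))

/-- The degree `n` part of `R`. -/
def invariantPiece (b : Module.Basis ι k V) (ρ : Representation k G V) (n : ℕ) :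
    Submodule k (invariantRing b ρ) :=
  (homogeneousSubmodule ι k n).comap (invariantRing b ρ).val.toLinearMap

/-- The ideal `I` of `k[V]` generated by the invariants of positive degree. -/
def hilbertIdeal (b : Module.Basis ι k V) (ρ : Representation k G V) :
    Ideal (MvPolynomial ι k) :=
  Ideal.span {p | p ∈ invariantRing b ρ ∧ ∃ n, 0 < n ∧ p.IsHomogeneous n}

/-- The degree `n` part of `I`. -/
def hilbertIdealPiece (b : Module.Basis ι k V) (ρ : Representation k G V) (n : ℕ) :
    Submodule k (hilbertIdeal b ρ) :=
  (homogeneousSubmodule ι k n).comap ((hilbertIdeal b ρ).subtype.restrictScalars k)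

/-- `τ_G(V)`, the smallest positive degree in which `I` and `k[V]` agree. -/
def tau (b : Module.Basis ι k V) (ρ : Representation k G V) : ℕ :=
  sInf {n | 0 < n ∧ ∀ p : MvPolynomial ι k, p.IsHomogeneous n → p ∈ hilbertIdeal b ρ}

/-- The inclusion of `R` in `k[V]` is split as a map of `R`-modules. -/
def IsSplitInvariants (b : Module.Basis ι k V) (ρ : Representation k G V) : Prop :=
  ∃ π : MvPolynomial ι k →ₗ[invariantRing b ρ] invariantRing b ρ,
    ∀ x : invariantRing b ρ, π (x : MvPolynomial ι k) = x

/-- The `f j` are homogeneous of degrees `e j` and form a minimal set of generators of the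
`k`-algebra `R`. -/
structure IsMinimalGenerators (b : Module.Basis ι k V) (ρ : Representation k G V) {r : ℕ}
    (f : Fin r → invariantRing b ρ) (e : Fin r → ℕ) : Prop where
  homogeneous : ∀ j, f j ∈ invariantPiece b ρ (e j)
  generates : Algebra.adjoin k (Set.range f) = ⊤
  minimal : ∀ j, Algebra.adjoin k (f '' {j}ᶜ) ≠ ⊤

/-- `t_i^S(R)`, where `S = k[x_1, …, x_r]` is graded by `deg x_j = e j` and acts on `R` through
the map of `k`-algebras `S → R` that sends `x_j` to `f j`. -/
def invariantTorEnd (b : Module.Basis ι k V) (ρ : Representation k G V) {r : ℕ}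
    (f : Fin r → invariantRing b ρ) (e : Fin r → ℕ) (i : ℕ) : EReal :=
  letI : Module (MvPolynomial (Fin r) k) (invariantRing b ρ) :=
    Module.compHom (invariantRing b ρ)
      (aeval f : MvPolynomial (Fin r) k →ₐ[k] invariantRing b ρ).toRingHom
  torEnd (weightedHomogeneousSubmodule k e) (invariantPiece b ρ) i

/-- `t_i^B(I)`, where `B = k[V]` is standard graded. -/
def hilbertIdealTorEnd (b : Module.Basis ι k V) (ρ : Representation k G V) (i : ℕ) : EReal :=
  torEnd (homogeneousSubmodule ι k) (hilbertIdealPiece b ρ) i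

end Invariants

end

-- Write B = k[V], τ = τ_G(V), and K(f; N) for the Koszul complex of f_1, …, f_r on N, with homology
-- H_q(f; N). Tor over S is controlled by H_i(f; R) (`mem_boundaries_of_acyclic`). The splitting can
-- be made to preserve degrees (`IsSplitInvariants.exists_graded`), so K(f; R) is a graded retract
-- of K(f; B) (`Acyclic.of_retract`). It remains to show that H_q(f; B) vanishes in degrees at least
-- β(q), where β(q) is (q+1)τ + q in general and (q+1)τ under the extra hypothesis.
--
-- This is `acyclic_of_ideal`, by strong induction on q. Minimal generators have degree at most τ
-- (`degree_le_tau`), so a q-cycle of degree d ≥ (q+1)τ has coefficients of degree at least τ, which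
-- lie in I. Let F → I be the free cover on the f_j, with kernel Z. The cycle lifts from K(f; I) to
-- a cycle of K(f; F) if H_{q-1}(f; Z) vanishes in degree d. Dimension shifting
-- (`acyclic_of_syzygies`) reduces this to the vanishing of H_p(f; B), p < q, in the degrees d - c
-- with c ≤ t_{q-p}, where t_s bounds the degrees of Tor_s^B(I, k). The induction hypothesis
-- provides it when β(p) + t_{q-p} ≤ β(q). The image in K(f; B) of the lifted cycle is a sum of
-- terms f_j g_j with cycles g_j, and multiplication by f_j is null homotopic (`exists_homotopy`),
-- so it is a boundary.
--
-- Since I contains all forms of degree at least τ, one may take t_s = τ + s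
-- (`acyclic_ideal_of_forall_mem`). The hypothesis t_1 ≤ τ improves the value at s = 1, and this
-- admits β(q) = (q+1)τ if τ ≥ 2. If τ = 1, it forces dim V ≤ 1, and there are no higher syzygies.
--
-- Finally τ ≤ |G| is Benson's proof of the Noether bound (`prod_mem_of_forall_mem`). Independence
-- of characters lets it run with an arbitrary splitting in place of the averaging operator.

universe u₁ u₂

/-! ### Koszul complexes of commuting endomorphisms -/

namespace Koszul

/-- The underlying group `N ⊗ Λ(ℤ^l)` of a Koszul complex with coefficients in `N`, built as an
iterated mapping cone. -/
def Kos {σ : Type w} (N : Type u) : List σ → Type u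
  | [] => N
  | _ :: l => Kos N l × Kos N l

section

variable {σ : Type w} {N : Type u}

/-- A coefficient, as an element of the Koszul complex of the empty sequence. -/
def single (x : N) : Kos N ([] : List σ) := x

/-- An element of a Koszul complex as a pair of elements of the one that it is a cone of. -/
def pair (j : σ) {l : List σ} (α β : Kos N l) : Kos N (j :: l) := (α, β)

theorem exists_single (z : Kos N ([] : List σ)) : ∃ x : N, single x = z := ⟨z, rfl⟩

theorem exists_pair {j : σ} {l : List σ} (z : Kos N (j :: l)) : ∃ α β, pair j α β = z :=
  ⟨z.1, z.2, rfl⟩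

theorem pair_inj {j : σ} {l : List σ} {α β α' β' : Kos N l} :
    pair j α β = pair j α' β' ↔ α = α' ∧ β = β' := Prod.mk_inj

end

variable {σ : Type w} {N : Type u} {N' : Type u₁} {N'' : Type u₂}
  [AddCommGroup N] [AddCommGroup N'] [AddCommGroup N'']

instance instAddCommGroup : (l : List σ) → AddCommGroup (Kos N l)
  | [] => inferInstanceAs (AddCommGroup N)
  | _ :: l =>
    letI := instAddCommGroup l
    inferInstanceAs (AddCommGroup (Kos N l × Kos N l))

/-- The map of Koszul complexes induced by a map of coefficients. -/
def map (φ : N →+ N') : (l : List σ) → Kos N l →+ Kos N' l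
  | [] => φ
  | _ :: l => (map φ l).prodMap (map φ l)

/-- The Koszul differential of the endomorphisms `a j`, for `j` in `l`. -/
def bd (a : σ → (N →+ N)) : (l : List σ) → Kos N l →+ Kos N l
  | [] => 0
  | j :: l => AddMonoidHom.prod
      ((bd a l).comp (AddMonoidHom.fst (Kos N l) (Kos N l)) +
        (map (a j) l).comp (AddMonoidHom.snd (Kos N l) (Kos N l)))
      (-((bd a l).comp (AddMonoidHom.snd (Kos N l) (Kos N l))))

/-- The part of homological degree `p` and internal degree `d`, when the generator `j` has
internal degree `e j`. -/
def piece (e : σ → ℤ) (P : ℤ → AddSubgroup N) : (l : List σ) → ℤ → ℤ → AddSubgroup (Kos N l)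
  | [], p, d => if p = 0 then P d else ⊥
  | j :: l, p, d => (piece e P l p d).prod (piece e P l (p - 1) (d - e j))

/-- Vanishing of Koszul homology in homological degree `p` and internal degree `d`. -/
def Acyclic (e : σ → ℤ) (P : ℤ → AddSubgroup N) (a : σ → (N →+ N)) (l : List σ)
    (p d : ℤ) : Prop :=
  ∀ z ∈ piece e P l p d, bd a l z = 0 → ∃ w ∈ piece e P l (p + 1) d, bd a l w = z

theorem single_zero : single (0 : N) = (0 : Kos N ([] : List σ)) := rfl

theorem pair_zero (j : σ) (l : List σ) : pair j (0 : Kos N l) 0 = 0 := rfl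

theorem pair_add (j : σ) {l : List σ} (α β α' β' : Kos N l) :
    pair j α β + pair j α' β' = pair j (α + α') (β + β') := rfl

theorem map_pair (φ : N →+ N') (j : σ) (l : List σ) (α β : Kos N l) :
    map φ (j :: l) (pair j α β) = pair j (map φ l α) (map φ l β) := rfl

theorem bd_nil (a : σ → (N →+ N)) (z : Kos N ([] : List σ)) : bd a [] z = 0 := rfl

theorem bd_pair (a : σ → (N →+ N)) (j : σ) (l : List σ) (α β : Kos N l) :
    bd a (j :: l) (pair j α β) = pair j (bd a l α + map (a j) l β) (-bd a l β) := rfl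

section

variable {e : σ → ℤ} {P : ℤ → AddSubgroup N}

theorem single_mem_piece {d : ℤ} {x : N} : single x ∈ piece e P [] 0 d ↔ x ∈ P d := by
  have h : piece e P [] 0 d = P d := if_pos rfl
  rw [h]
  rfl

theorem mem_piece_nil_of_ne {p d : ℤ} (hp : p ≠ 0) {z : Kos N ([] : List σ)} :
    z ∈ piece e P [] p d ↔ z = 0 := by
  have h : piece e P [] p d = (⊥ : AddSubgroup N) := if_neg hp
  rw [h]
  rfl

theorem pair_mem_piece {j : σ} {l : List σ} {p d : ℤ} {α β : Kos N l} :
    pair j α β ∈ piece e P (j :: l) p d ↔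
      α ∈ piece e P l p d ∧ β ∈ piece e P l (p - 1) (d - e j) := Iff.rfl

end

theorem map_map (φ : N →+ N') (ψ : N' →+ N'') (l : List σ) (z : Kos N l) :
    map ψ l (map φ l z) = map (ψ.comp φ) l z := by
  induction l with
  | nil => rfl
  | cons j l ih =>
    obtain ⟨α, β, rfl⟩ := exists_pair z
    simp only [map_pair, ih]

theorem map_id (l : List σ) (z : Kos N l) : map (AddMonoidHom.id N) l z = z := by
  induction l with
  | nil => rfl
  | cons j l ih =>
    obtain ⟨α, β, rfl⟩ := exists_pair z
    simp only [map_pair, ih]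

theorem map_zero_hom (l : List σ) (z : Kos N l) : map (0 : N →+ N') l z = 0 := by
  induction l with
  | nil => rfl
  | cons j l ih =>
    obtain ⟨α, β, rfl⟩ := exists_pair z
    simp only [map_pair, ih, pair_zero]

theorem bd_map {φ : N →+ N'} {a : σ → (N →+ N)} {a' : σ → (N' →+ N')} (l : List σ)
    (h : ∀ j ∈ l, ∀ x, φ (a j x) = a' j (φ x)) (z : Kos N l) :
    bd a' l (map φ l z) = map φ l (bd a l z) := by
  induction l with
  | nil => rw [bd_nil, bd_nil, map_zero]
  | cons j l ih =>
    obtain ⟨α, β, rfl⟩ := exists_pair z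
    have hc : map (a' j) l (map φ l β) = map φ l (map (a j) l β) := by
      rw [map_map, map_map]
      exact congrArg (fun χ => map χ l β)
        (AddMonoidHom.ext fun x => (h j List.mem_cons_self x).symm)
    have ih := ih fun i hi => h i (List.mem_cons_of_mem j hi)
    simp only [map_pair, bd_pair, ih, map_add, map_neg, hc]

theorem bd_bd {a : σ → (N →+ N)} (h : ∀ i j x, a i (a j x) = a j (a i x)) (l : List σ)
    (z : Kos N l) : bd a l (bd a l z) = 0 := by
  induction l with
  | nil => rfl
  | cons j l ih =>
    obtain ⟨α, β, rfl⟩ := exists_pair z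
    have hc := bd_map (φ := a j) (a := a) (a' := a) l (fun i _ x => h j i x) β
    simp only [bd_pair, ih, map_add, map_neg, hc, zero_add, neg_zero, add_neg_cancel, pair_zero]

/-! ### Bigraded pieces, null homotopies and the long exact sequence of Koszul homology. -/

section Pieces

variable {e : σ → ℤ} {P : ℤ → AddSubgroup N} {P' : ℤ → AddSubgroup N'}
  {P'' : ℤ → AddSubgroup N''}

theorem map_mem_piece_shift {φ : N →+ N'} {c : ℤ} (h : ∀ n, ∀ x ∈ P n, φ x ∈ P' (n + c))
    (l : List σ) {p d : ℤ} {z : Kos N l} (hz : z ∈ piece e P l p d) :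
    map φ l z ∈ piece e P' l p (d + c) := by
  induction l generalizing p d with
  | nil =>
    obtain ⟨x, rfl⟩ := exists_single z
    rcases eq_or_ne p 0 with rfl | hp
    · exact single_mem_piece.2 (h _ _ (single_mem_piece.1 hz))
    · rw [(mem_piece_nil_of_ne hp).1 hz, map_zero]
      exact zero_mem _
  | cons j l ih =>
    obtain ⟨α, β, rfl⟩ := exists_pair z
    rw [pair_mem_piece] at hz
    rw [map_pair, pair_mem_piece]
    refine ⟨ih hz.1, ?_⟩
    have := ih hz.2
    rwa [sub_add_eq_add_sub] at this

theorem map_mem_piece {φ : N →+ N'} (h : ∀ n, ∀ x ∈ P n, φ x ∈ P' n)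
    (l : List σ) {p d : ℤ} {z : Kos N l} (hz : z ∈ piece e P l p d) :
    map φ l z ∈ piece e P' l p d := by
  have := map_mem_piece_shift (P' := P') (c := 0) (φ := φ) (e := e)
    (fun n x hx => by simpa using h n x hx) l hz
  rwa [add_zero] at this

theorem bd_mem_piece {a : σ → (N →+ N)} (h : ∀ j n, ∀ x ∈ P n, a j x ∈ P (n + e j))
    (l : List σ) {p d : ℤ} {z : Kos N l} (hz : z ∈ piece e P l p d) :
    bd a l z ∈ piece e P l (p - 1) d := by
  induction l generalizing p d with
  | nil => exact zero_mem _
  | cons j l ih =>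
    obtain ⟨α, β, rfl⟩ := exists_pair z
    rw [pair_mem_piece] at hz
    rw [bd_pair, pair_mem_piece]
    refine ⟨add_mem (ih hz.1) ?_, neg_mem (ih hz.2)⟩
    have := map_mem_piece_shift (e := e) (h j) l hz.2
    rwa [sub_add_cancel] at this

theorem exists_lift {φ : N →+ N'} (h : ∀ n, ∀ y ∈ P' n, ∃ x ∈ P n, φ x = y)
    (l : List σ) {p d : ℤ} {z : Kos N' l} (hz : z ∈ piece e P' l p d) :
    ∃ y ∈ piece e P l p d, map φ l y = z := by
  induction l generalizing p d with
  | nil =>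
    obtain ⟨x, rfl⟩ := exists_single z
    rcases eq_or_ne p 0 with rfl | hp
    · obtain ⟨y, hy, rfl⟩ := h _ _ (single_mem_piece.1 hz)
      exact ⟨single y, single_mem_piece.2 hy, rfl⟩
    · exact ⟨0, zero_mem _, by rw [(mem_piece_nil_of_ne hp).1 hz, map_zero]⟩
  | cons j l ih =>
    obtain ⟨α, β, rfl⟩ := exists_pair z
    rw [pair_mem_piece] at hz
    obtain ⟨α', hα', rfl⟩ := ih hz.1
    obtain ⟨β', hβ', rfl⟩ := ih hz.2
    exact ⟨pair j α' β', pair_mem_piece.2 ⟨hα', hβ'⟩, rfl⟩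

theorem map_injective {φ : N →+ N'} (h : Function.Injective φ) (l : List σ) :
    Function.Injective (map φ l) := by
  induction l with
  | nil => exact h
  | cons j l ih =>
    intro z w hzw
    obtain ⟨α, β, rfl⟩ := exists_pair z
    obtain ⟨α', β', rfl⟩ := exists_pair w
    rw [map_pair, map_pair, pair_inj] at hzw
    rw [ih hzw.1, ih hzw.2]

theorem exists_of_map_eq_zero {ι : N' →+ N} {φ : N →+ N''}
    (h : ∀ n, ∀ x ∈ P n, φ x = 0 → ∃ y ∈ P' n, ι y = x)
    (l : List σ) {p d : ℤ} {z : Kos N l} (hz : z ∈ piece e P l p d) (h0 : map φ l z = 0) :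
    ∃ y ∈ piece e P' l p d, map ι l y = z := by
  induction l generalizing p d with
  | nil =>
    obtain ⟨x, rfl⟩ := exists_single z
    rcases eq_or_ne p 0 with rfl | hp
    · obtain ⟨y, hy, rfl⟩ := h _ _ (single_mem_piece.1 hz) h0
      exact ⟨single y, single_mem_piece.2 hy, rfl⟩
    · exact ⟨0, zero_mem _, by rw [(mem_piece_nil_of_ne hp).1 hz, map_zero]⟩
  | cons j l ih =>
    obtain ⟨α, β, rfl⟩ := exists_pair z
    rw [pair_mem_piece] at hz
    rw [map_pair, ← pair_zero, pair_inj] at h0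
    obtain ⟨α', hα', rfl⟩ := ih hz.1 h0.1
    obtain ⟨β', hβ', rfl⟩ := ih hz.2 h0.2
    exact ⟨pair j α' β', pair_mem_piece.2 ⟨hα', hβ'⟩, rfl⟩

theorem eq_zero_of_mem_piece_of_neg (l : List σ) {p d : ℤ} (hp : p < 0) {z : Kos N l}
    (hz : z ∈ piece e P l p d) : z = 0 := by
  induction l generalizing p d with
  | nil => exact (mem_piece_nil_of_ne hp.ne).1 hz
  | cons j l ih =>
    obtain ⟨α, β, rfl⟩ := exists_pair z
    rw [pair_mem_piece] at hz
    rw [ih hp hz.1, ih (by omega) hz.2, pair_zero]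

theorem eq_zero_of_mem_piece_of_length_lt (l : List σ) {p d : ℤ} (hp : (l.length : ℤ) < p)
    {z : Kos N l} (hz : z ∈ piece e P l p d) : z = 0 := by
  induction l generalizing p d with
  | nil => exact (mem_piece_nil_of_ne (by simpa using hp.ne')).1 hz
  | cons j l ih =>
    obtain ⟨α, β, rfl⟩ := exists_pair z
    rw [pair_mem_piece] at hz
    rw [List.length_cons] at hp
    push_cast at hp
    rw [ih (by omega) hz.1, ih (by omega) hz.2, pair_zero]

/-- If all weights are at most `c`, then a chain of homological degree `p` and internal degree
`d` has its coefficients in degrees at least `d - p * c`. -/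
theorem piece_le_piece {c : ℤ} (he : ∀ j, e j ≤ c) {Q : ℤ → AddSubgroup N}
    (l : List σ) {p d : ℤ} (h : ∀ n, d - p * c ≤ n → P n ≤ Q n) :
    piece e P l p d ≤ piece e Q l p d := by
  intro z hz
  induction l generalizing p d with
  | nil =>
    obtain ⟨x, rfl⟩ := exists_single z
    rcases eq_or_ne p 0 with rfl | hp
    · exact single_mem_piece.2 (h d (by simp) (single_mem_piece.1 hz))
    · rwa [mem_piece_nil_of_ne hp] at hz ⊢
  | cons j l ih =>
    obtain ⟨α, β, rfl⟩ := exists_pair z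
    rw [pair_mem_piece] at hz ⊢
    refine ⟨ih h hz.1, ih (fun n hn => h n ?_) hz.2⟩
    have := he j
    linarith

/-- The inclusion of the coefficients as the part of homological degree zero. -/
def incl : (l : List σ) → N →+ Kos N l
  | [] => AddMonoidHom.id N
  | _ :: l => AddMonoidHom.prod (incl l) (0 : N →+ Kos N l)

theorem incl_cons (j : σ) (l : List σ) (x : N) : incl (j :: l) x = pair j (incl l x) 0 := rfl

theorem map_incl (φ : N →+ N') (l : List σ) (x : N) : map φ l (incl l x) = incl l (φ x) := by
  induction l with
  | nil => rfl
  | cons j l ih => rw [incl_cons, map_pair, ih, map_zero, incl_cons]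

theorem bd_incl (a : σ → (N →+ N)) (l : List σ) (x : N) : bd a l (incl l x) = 0 := by
  induction l with
  | nil => rfl
  | cons j l ih => rw [incl_cons, bd_pair, ih, map_zero, map_zero, neg_zero, add_zero, pair_zero]

theorem incl_injective (l : List σ) : Function.Injective (incl (N := N) l) := by
  induction l with
  | nil => exact fun _ _ h => h
  | cons j l ih =>
    intro x y h
    rw [incl_cons, incl_cons, pair_inj] at h
    exact ih h.1

theorem incl_mem_piece (l : List σ) {d : ℤ} {x : N} (hx : x ∈ P d) :
    incl l x ∈ piece e P l 0 d := by
  induction l with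
  | nil => exact single_mem_piece.2 hx
  | cons j l ih => exact pair_mem_piece.2 ⟨ih, zero_mem _⟩

theorem exists_incl_of_mem_piece_zero (l : List σ) {d : ℤ} {z : Kos N l}
    (hz : z ∈ piece e P l 0 d) : ∃ x ∈ P d, incl l x = z := by
  induction l with
  | nil =>
    obtain ⟨x, rfl⟩ := exists_single z
    exact ⟨x, single_mem_piece.1 hz, rfl⟩
  | cons j l ih =>
    obtain ⟨α, β, rfl⟩ := exists_pair z
    rw [pair_mem_piece] at hz
    obtain ⟨x, hx, rfl⟩ := ih hz.1
    exact ⟨x, hx, by rw [incl_cons, eq_zero_of_mem_piece_of_neg l (by norm_num) hz.2]⟩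

/-- Multiplication by each of the endomorphisms is null homotopic on the Koszul complex. -/
theorem exists_homotopy (e : σ → ℤ) (P : ℤ → AddSubgroup N) (a : σ → (N →+ N))
    (l : List σ) {i : σ} (hi : i ∈ l) :
    ∃ h : Kos N l →+ Kos N l, (∀ (φ : N →+ N) z, h (map φ l z) = map φ l (h z)) ∧
      (∀ z, bd a l (h z) + h (bd a l z) = map (a i) l z) ∧
      ∀ p d, ∀ z ∈ piece e P l p d, h z ∈ piece e P l (p + 1) (d + e i) := by
  classical
  induction l with
  | nil => exact absurd hi (by simp)
  | cons j l ih =>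
    by_cases hij : i = j
    · subst hij
      -- Exterior multiplication by the generator of index `i`.
      let h : Kos N (i :: l) →+ Kos N (i :: l) :=
        AddMonoidHom.prod (0 : Kos N l × Kos N l →+ Kos N l) (AddMonoidHom.fst _ _)
      have hh : ∀ α β, h (pair i α β) = pair i 0 α := fun α β => rfl
      refine ⟨h, ?_, ?_, ?_⟩
      · intro φ z
        obtain ⟨α, β, rfl⟩ := exists_pair z
        simp only [hh, map_pair, map_zero]
      · intro z
        obtain ⟨α, β, rfl⟩ := exists_pair z
        simp only [hh, map_pair, bd_pair, pair_add, map_zero, zero_add, add_zero,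
          neg_add_cancel_left]
      · intro p d z hz
        obtain ⟨α, β, rfl⟩ := exists_pair z
        rw [pair_mem_piece] at hz
        rw [hh, pair_mem_piece, add_sub_cancel_right, add_sub_cancel_right]
        exact ⟨zero_mem _, hz.1⟩
    · obtain ⟨h, h1, h2, h3⟩ := ih ((List.mem_cons.1 hi).resolve_left hij)
      -- The sign matches the sign of the differential on the second component of the cone.
      let h' : Kos N (j :: l) →+ Kos N (j :: l) := AddMonoidHom.prodMap h (-h)
      have hh : ∀ α β, h' (pair j α β) = pair j (h α) (-h β) := fun α β => rfl
      refine ⟨h', ?_, ?_, ?_⟩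
      · intro φ z
        obtain ⟨α, β, rfl⟩ := exists_pair z
        simp only [hh, map_pair, h1, map_neg]
      · intro z
        obtain ⟨α, β, rfl⟩ := exists_pair z
        simp only [hh, map_pair, bd_pair, pair_add, map_neg, map_add, neg_neg, h1, ← h2 α,
          ← h2 β]
        congr 1
        abel
      · intro p d z hz
        obtain ⟨α, β, rfl⟩ := exists_pair z
        rw [pair_mem_piece] at hz
        rw [hh, pair_mem_piece]
        refine ⟨h3 _ _ _ hz.1, neg_mem ?_⟩
        have := h3 _ _ _ hz.2
        rwa [sub_add_cancel, sub_add_eq_add_sub, ← add_sub_cancel_right p 1] at this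

theorem exists_bd_eq_map (a : σ → (N →+ N)) (l : List σ) {i : σ} (hi : i ∈ l) {p d : ℤ}
    {z : Kos N l} (hz : z ∈ piece e P l p d) (h0 : bd a l z = 0) :
    ∃ w ∈ piece e P l (p + 1) (d + e i), bd a l w = map (a i) l z := by
  obtain ⟨h, -, h2, h3⟩ := exists_homotopy e P a l hi
  refine ⟨h z, h3 _ _ _ hz, ?_⟩
  rw [← h2, h0, map_zero, add_zero]

/-- A coefficient is a boundary if and only if it is a combination of values of the
endomorphisms. -/
theorem exists_bd_eq_incl_iff (a : σ → (N →+ N)) (l : List σ) {d : ℤ} {x : N} :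
    (∃ w ∈ piece e P l 1 d, bd a l w = incl l x) ↔
      x ∈ ⨆ i ∈ l, (P (d - e i)).map (a i) := by
  constructor
  · rintro ⟨w, hw, hwx⟩
    suffices h : ∃ y ∈ ⨆ i ∈ l, (P (d - e i)).map (a i), bd a l w = incl l y by
      obtain ⟨y, hy, h⟩ := h
      rwa [incl_injective l (hwx.symm.trans h)]
    clear hwx x
    induction l with
    | nil => exact ⟨0, zero_mem _, rfl⟩
    | cons j l ih =>
      obtain ⟨α, β, rfl⟩ := exists_pair w
      rw [pair_mem_piece] at hw
      obtain ⟨y, hy, h⟩ := ih α hw.1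
      have hβ := hw.2
      rw [sub_self] at hβ
      obtain ⟨b, hb, rfl⟩ := exists_incl_of_mem_piece_zero l hβ
      refine ⟨y + a j b, add_mem ?_ ?_, ?_⟩
      · have hle : (⨆ i ∈ l, (P (d - e i)).map (a i)) ≤
            ⨆ i ∈ j :: l, (P (d - e i)).map (a i) :=
          iSup₂_mono' fun i hi => ⟨i, List.mem_cons_of_mem j hi, le_rfl⟩
        exact hle hy
      · exact (le_iSup₂_of_le j List.mem_cons_self le_rfl : (P (d - e j)).map (a j) ≤ _)
          ⟨b, hb, rfl⟩
      · rw [bd_pair, h, bd_incl, neg_zero, map_incl, incl_cons, map_add]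
  · intro hx
    -- The coefficients that are boundaries form a subgroup, so it is enough to treat one
    -- endomorphism at a time, and there the null homotopy gives the bounding chain.
    let T : AddSubgroup N :=
      ((piece e P l 1 d).map (bd a l)).comap (incl l)
    suffices h : (⨆ i ∈ l, (P (d - e i)).map (a i)) ≤ T from h hx
    refine iSup₂_le fun i hi => ?_
    rintro _ ⟨b, hb, rfl⟩
    obtain ⟨w, hw, h⟩ := exists_bd_eq_map a l hi (incl_mem_piece (e := e) l hb) (bd_incl a l b)
    rw [zero_add, sub_add_cancel] at hw
    exact ⟨w, hw, h.trans (map_incl _ _ _)⟩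

theorem acyclic_zero_iff {a : σ → (N →+ N)} {l : List σ} {d : ℤ} :
    Acyclic e P a l 0 d ↔ P d ≤ ⨆ i ∈ l, (P (d - e i)).map (a i) := by
  constructor
  · intro h x hx
    rw [← exists_bd_eq_incl_iff]
    simpa using h _ (incl_mem_piece l hx) (bd_incl a l x)
  · intro h z hz _
    obtain ⟨x, hx, rfl⟩ := exists_incl_of_mem_piece_zero l hz
    rw [zero_add]
    exact (exists_bd_eq_incl_iff a l).2 (h hx)

theorem acyclic_of_neg {a : σ → (N →+ N)} {l : List σ} {p d : ℤ} (hp : p < 0) :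
    Acyclic e P a l p d := by
  intro z hz _
  exact ⟨0, zero_mem _, by rw [eq_zero_of_mem_piece_of_neg l hp hz, map_zero]⟩

theorem acyclic_of_length_lt {a : σ → (N →+ N)} {l : List σ} {p d : ℤ}
    (hp : (l.length : ℤ) < p) : Acyclic e P a l p d := by
  intro z hz _
  exact ⟨0, zero_mem _, by rw [eq_zero_of_mem_piece_of_length_lt l hp hz, map_zero]⟩

/-- Acyclicity passes to a retract. -/
theorem Acyclic.of_retract {a : σ → (N →+ N)} {a' : σ → (N' →+ N')}
    {l : List σ} {p d : ℤ} (h : Acyclic e P a l p d) (ι : N' →+ N) (π : N →+ N')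
    (hι : ∀ j x, ι (a' j x) = a j (ι x)) (hπ : ∀ j x, π (a j x) = a' j (π x))
    (hPι : ∀ n, ∀ x ∈ P' n, ι x ∈ P n) (hPπ : ∀ n, ∀ x ∈ P n, π x ∈ P' n)
    (hπι : ∀ x, π (ι x) = x) : Acyclic e P' a' l p d := by
  intro z hz h0
  obtain ⟨w, hw, h⟩ := h (map ι l z) (map_mem_piece hPι l hz)
    (by rw [bd_map l (fun j _ => hι j), h0, map_zero])
  refine ⟨map π l w, map_mem_piece hPπ l hw, ?_⟩
  rw [bd_map l (fun j _ => hπ j), h, map_map,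
    show π.comp ι = AddMonoidHom.id N' from AddMonoidHom.ext hπι, map_id]

/-- A short exact sequence `0 → N' → N → N'' → 0` of graded groups compatible with the
endomorphisms. -/
structure ShortExact (P' : ℤ → AddSubgroup N') (P : ℤ → AddSubgroup N)
    (P'' : ℤ → AddSubgroup N'') (a' : σ → (N' →+ N')) (a : σ → (N →+ N))
    (a'' : σ → (N'' →+ N'')) (ι : N' →+ N) (φ : N →+ N'') : Prop where
  inj : Function.Injective ι
  comp : ∀ x, φ (ι x) = 0
  mem_ι : ∀ n, ∀ x ∈ P' n, ι x ∈ P n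
  mem_φ : ∀ n, ∀ x ∈ P n, φ x ∈ P'' n
  lift : ∀ n, ∀ y ∈ P'' n, ∃ x ∈ P n, φ x = y
  ker : ∀ n, ∀ x ∈ P n, φ x = 0 → ∃ y ∈ P' n, ι y = x
  comm_ι : ∀ j x, ι (a' j x) = a j (ι x)
  comm_φ : ∀ j x, φ (a j x) = a'' j (φ x)

namespace ShortExact

variable {a' : σ → (N' →+ N')} {a : σ → (N →+ N)} {φ : N →+ N''}
  {a'' : σ → (N'' →+ N'')} {ι : N' →+ N}

/-- A cycle lifts to a cycle if the chains of `N'` that are boundaries in `N` are boundaries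
in `N'`. -/
theorem exists_cycle_lift (S : ShortExact P' P P'' a' a a'' ι φ)
    (hP : ∀ j n, ∀ x ∈ P n, a j x ∈ P (n + e j)) {l : List σ} {p d : ℤ}
    (h' : ∀ u ∈ piece e P' l (p - 1) d, (∃ v ∈ piece e P l p d, bd a l v = map ι l u) →
      ∃ w ∈ piece e P' l p d, bd a' l w = u)
    {z : Kos N'' l} (hz : z ∈ piece e P'' l p d) (h0 : bd a'' l z = 0) :
    ∃ y ∈ piece e P l p d, bd a l y = 0 ∧ map φ l y = z := by
  obtain ⟨y, hy, rfl⟩ := exists_lift S.lift l hz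
  obtain ⟨u, hu, hyu⟩ := exists_of_map_eq_zero (ι := ι) (φ := φ) S.ker l
    (bd_mem_piece hP l hy) (by rw [← bd_map l (fun j _ => S.comm_φ j), h0])
  obtain ⟨w, hw, rfl⟩ := h' u hu ⟨y, hy, hyu.symm⟩
  -- The boundary of a lift `y` comes from `N'`, where it bounds `w`. Subtracting `w` makes the lift
  -- a cycle.
  refine ⟨y - map ι l w, sub_mem hy (map_mem_piece S.mem_ι l hw), ?_, ?_⟩
  · rw [map_sub, bd_map l (fun j _ => S.comm_ι j), hyu, sub_self]
  · rw [map_sub, map_map, show φ.comp ι = 0 from AddMonoidHom.ext S.comp, map_zero_hom, sub_zero]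

/-- Supplies the lifting condition of `exists_cycle_lift`: a chain of `N'` that bounds in `N` is a
cycle, because `ι` is injective. -/
theorem exists_bd_of_acyclic (S : ShortExact P' P P'' a' a a'' ι φ)
    (ha : ∀ i j x, a i (a j x) = a j (a i x)) {l : List σ} {p d : ℤ}
    (h' : Acyclic e P' a' l (p - 1) d) {u : Kos N' l} (hu : u ∈ piece e P' l (p - 1) d)
    (hv : ∃ v ∈ piece e P l p d, bd a l v = map ι l u) :
    ∃ w ∈ piece e P' l p d, bd a' l w = u := by
  obtain ⟨v, -, hv⟩ := hv
  have := h' u hu (map_injective S.inj l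
    (by rw [← bd_map l (fun j _ => S.comm_ι j), ← hv, bd_bd ha, map_zero]))
  rwa [sub_add_cancel] at this

/-- Exactness of H_p(N) → H_p(N'') → H_{p-1}(N'). Only the image of the connecting map has to
vanish, and `h'` asks no more than that; `GradedFreeResolution.acyclic_one` needs this weaker form.
-/
theorem acyclic_right (S : ShortExact P' P P'' a' a a'' ι φ)
    (hP : ∀ j n, ∀ x ∈ P n, a j x ∈ P (n + e j)) {l : List σ} {p d : ℤ}
    (h : Acyclic e P a l p d)
    (h' : ∀ u ∈ piece e P' l (p - 1) d, (∃ v ∈ piece e P l p d, bd a l v = map ι l u) →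
      ∃ w ∈ piece e P' l p d, bd a' l w = u) : Acyclic e P'' a'' l p d := by
  intro z hz h0
  obtain ⟨y, hy, hy0, rfl⟩ := S.exists_cycle_lift hP h' hz h0
  obtain ⟨v, hv, rfl⟩ := h y hy hy0
  exact ⟨map φ l v, map_mem_piece S.mem_φ l hv, bd_map l (fun j _ => S.comm_φ j) v⟩

/-- Exactness of H_{p+1}(N'') → H_p(N') → H_p(N) in the middle. -/
theorem exists_bd_left (S : ShortExact P' P P'' a' a a'' ι φ)
    (hP : ∀ j n, ∀ x ∈ P n, a j x ∈ P (n + e j)) (ha : ∀ i j x, a i (a j x) = a j (a i x))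
    {l : List σ} {p d : ℤ} (h : Acyclic e P'' a'' l (p + 1) d) (u : Kos N' l)
    (hv : ∃ v ∈ piece e P l (p + 1) d, bd a l v = map ι l u) :
    ∃ w ∈ piece e P' l (p + 1) d, bd a' l w = u := by
  obtain ⟨v, hv, hvu⟩ := hv
  obtain ⟨w, hw, hwv⟩ := h (map φ l v) (map_mem_piece S.mem_φ l hv) (by
    rw [bd_map l (fun j _ => S.comm_φ j), hvu, map_map,
      show φ.comp ι = 0 from AddMonoidHom.ext S.comp,
      map_zero_hom])
  obtain ⟨y, hy, rfl⟩ := exists_lift S.lift l hw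
  have hyp := bd_mem_piece hP l hy
  rw [add_sub_cancel_right] at hyp
  obtain ⟨x, hx, hxv⟩ := exists_of_map_eq_zero (ι := ι) (φ := φ) S.ker l (sub_mem hv hyp)
    (by rw [map_sub, ← bd_map l (fun j _ => S.comm_φ j), hwv, sub_self])
  refine ⟨x, hx, map_injective S.inj l ?_⟩
  rw [← bd_map l (fun j _ => S.comm_ι j), hxv, map_sub, bd_bd ha, sub_zero, hvu]

theorem acyclic_left (S : ShortExact P' P P'' a' a a'' ι φ)
    (hP : ∀ j n, ∀ x ∈ P n, a j x ∈ P (n + e j)) (ha : ∀ i j x, a i (a j x) = a j (a i x))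
    {l : List σ} {p d : ℤ} (h : Acyclic e P a l p d) (h'' : Acyclic e P'' a'' l (p + 1) d) :
    Acyclic e P' a' l p d := fun u hu h0 =>
  S.exists_bd_left hP ha h'' u
    (h _ (map_mem_piece S.mem_ι l hu) (by rw [bd_map l (fun j _ => S.comm_ι j), h0, map_zero]))

end ShortExact

end Pieces

/-! ### Koszul homology of direct sums. -/

section Finsupp

variable {J : Type v} {B : Type u} [AddCommGroup B]

/-- The grading of a direct sum of copies of `B`, shifted by `deg`. -/
def freeGrading (P : ℤ → AddSubgroup B) (deg : J → ℤ) (n : ℤ) : AddSubgroup (J →₀ B) where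
  carrier := {x | ∀ j, x j ∈ P (n - deg j)}
  zero_mem' := fun _ => zero_mem _
  add_mem' := fun hx hy j => add_mem (hx j) (hy j)
  neg_mem' := fun hx j => neg_mem (hx j)

theorem single_mem_freeGrading {P : ℤ → AddSubgroup B} {deg : J → ℤ} {n : ℤ} {j : J} {b : B}
    (hb : b ∈ P (n - deg j)) : Finsupp.single j b ∈ freeGrading P deg n := by
  classical
  intro i
  rw [Finsupp.single_apply]
  split_ifs with h
  · rwa [← h]
  · exact zero_mem _

/-- A chain has finitely many coefficients, each of finite support. Allowing every larger index set
`t` makes it possible to treat the two components of a cone with one set. -/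
theorem exists_eq_sum_map_single (l : List σ) (z : Kos (J →₀ B) l) :
    ∃ s : Finset J, ∀ t, s ⊆ t → z = ∑ j ∈ t,
      map (Finsupp.singleAddHom j) l (map (Finsupp.applyAddHom j) l z) := by
  classical
  induction l with
  | nil =>
    obtain ⟨x, rfl⟩ := exists_single z
    refine ⟨x.support, fun t ht => ?_⟩
    have : x = ∑ j ∈ t, Finsupp.single j (x j) := by
      conv_lhs => rw [← Finsupp.sum_single x]
      exact Finsupp.sum_of_support_subset x ht _ (fun i _ => Finsupp.single_zero i)
    exact this
  | cons j l ih =>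
    obtain ⟨α, β, rfl⟩ := exists_pair z
    obtain ⟨s, hs⟩ := ih α
    obtain ⟨s', hs'⟩ := ih β
    refine ⟨s ∪ s', fun t ht => ?_⟩
    have h : ∀ (t : Finset J) (x y : J → Kos (J →₀ B) l),
        ∑ i ∈ t, pair j (x i) (y i) = pair j (∑ i ∈ t, x i) (∑ i ∈ t, y i) := by
      intro t x y
      induction t using Finset.induction_on with
      | empty => simp only [Finset.sum_empty, pair_zero]
      | insert i t hi ih => simp only [Finset.sum_insert hi, ih, pair_add]
    simp only [map_pair, h]
    rw [← hs t (Finset.union_subset_left ht), ← hs' t (Finset.union_subset_right ht)]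

theorem acyclic_free {e : σ → ℤ} {P : ℤ → AddSubgroup B} {deg : J → ℤ} {a : σ → (B →+ B)}
    {a' : σ → ((J →₀ B) →+ (J →₀ B))} (ha : ∀ i g j, a' i g j = a i (g j)) {l : List σ}
    {p d : ℤ} (h : ∀ j, Acyclic e P a l p (d - deg j)) :
    Acyclic e (freeGrading P deg) a' l p d := by
  intro z hz h0
  have hmem : ∀ j, ∀ w ∈ piece e (freeGrading P deg) l p d,
      map (Finsupp.applyAddHom j) l w ∈ piece e P l p (d - deg j) := fun j w hw =>
    map_mem_piece_shift (P := freeGrading P deg) (P' := P) (c := -deg j)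
      (fun n x hx => hx j) l hw
  have hw : ∀ j, ∃ w ∈ piece e P l (p + 1) (d - deg j),
      bd a l w = map (Finsupp.applyAddHom j) l z := fun j => by
    refine h j _ (hmem j z hz) ?_
    rw [bd_map l (fun i _ g => ha i g j), h0, map_zero]
  choose w hw1 hw2 using hw
  obtain ⟨s, hs⟩ := exists_eq_sum_map_single l z
  refine ⟨∑ j ∈ s, map (Finsupp.singleAddHom j) l (w j), sum_mem fun j _ => ?_, ?_⟩
  · have := map_mem_piece_shift (P := P) (P' := freeGrading P deg) (c := deg j)
      (φ := Finsupp.singleAddHom j) (fun n x hx => single_mem_freeGrading (by simpa using hx)) l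
      (hw1 j)
    rwa [sub_add_cancel] at this
  · conv_rhs => rw [hs s subset_rfl]
    rw [map_sum]
    refine Finset.sum_congr rfl fun j _ => ?_
    rw [← hw2, bd_map l]
    intro i _ x
    ext j'
    rw [ha]
    classical
    simp only [Finsupp.singleAddHom_apply, Finsupp.single_apply]
    split_ifs
    · rfl
    · rw [map_zero]

end Finsupp

end Koszul

noncomputable section

/-! ### Acyclicity of the Koszul complex of the variables of a polynomial ring. -/

namespace Koszul

/-- A Koszul complex is acyclic if each of the endomorphisms has a left inverse that commutes with
the others. -/
theorem acyclic_of_leftInverse {σ : Type w} {N : Type u} [AddCommGroup N] {e : σ → ℤ}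
    {P : ℤ → AddSubgroup N} {a δ : σ → (N →+ N)} (ha : ∀ i j x, a i (a j x) = a j (a i x))
    (hδ : ∀ j x, δ j (a j x) = x) (hδa : ∀ i j, i ≠ j → ∀ x, δ j (a i x) = a i (δ j x))
    (hP : ∀ j n, ∀ x ∈ P n, a j x ∈ P (n + e j)) (hPδ : ∀ j n, ∀ x ∈ P n, δ j x ∈ P (n - e j))
    {l : List σ} (hl : l.Nodup) {p : ℤ} (hp : 0 < p) (d : ℤ) : Acyclic e P a l p d := by
  induction l with
  | nil =>
    intro z hz _
    exact ⟨0, zero_mem _, by rw [(mem_piece_nil_of_ne hp.ne').1 hz, map_zero]⟩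
  | cons j l ih =>
    have ih := ih hl.of_cons
    have hj : ∀ i ∈ l, i ≠ j := fun i hi h => (List.nodup_cons.1 hl).1 (h ▸ hi)
    intro z hz h0
    obtain ⟨α, β, rfl⟩ := exists_pair z
    rw [pair_mem_piece] at hz
    rw [bd_pair, ← pair_zero, pair_inj] at h0
    have hbδ : ∀ y, bd a l (map (δ j) l y) = map (δ j) l (bd a l y) :=
      bd_map l fun i hi x => hδa i j (hj i hi) x
    have hba : ∀ y, bd a l (map (a j) l y) = map (a j) l (bd a l y) :=
      bd_map l fun i _ x => ha j i x
    have hδβ : map (δ j) l (map (a j) l β) = β := by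
      rw [map_map, show (δ j).comp (a j) = AddMonoidHom.id N from AddMonoidHom.ext (hδ j), map_id]
    -- Applying δ_j to this identity shows that -δ_j α bounds `β`, and that α - a_j δ_j α is a
    -- cycle, to which the induction applies.
    have hα : bd a l α = -map (a j) l β := eq_neg_of_add_eq_zero_left h0.1
    have hδα : map (δ j) l α ∈ piece e P l p (d - e j) :=
      map_mem_piece_shift (c := -e j) (fun n x hx => hPδ j n x hx) l hz.1
    obtain ⟨c, hc, hcα⟩ := ih (α - map (a j) l (map (δ j) l α))
      (sub_mem hz.1 (by simpa using map_mem_piece_shift (e := e) (hP j) l hδα)) (by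
        rw [map_sub, hba, hbδ, hα, map_neg, hδβ, map_neg, sub_self])
    refine ⟨pair j c (map (δ j) l α), pair_mem_piece.2 ⟨hc, by rwa [add_sub_cancel_right]⟩, ?_⟩
    rw [bd_pair, hcα, sub_add_cancel, hbδ, hα, map_neg, neg_neg, hδβ]

/-- Scalar multiplications as endomorphisms. -/
def smulEnd {σ : Type w} {A : Type u} [CommRing A] (N : Type v) [AddCommGroup N] [Module A N]
    (x : σ → A) (j : σ) : N →+ N :=
  DistribSMul.toAddMonoidHom N (x j)

theorem smulEnd_apply {σ : Type w} {A : Type u} [CommRing A] {N : Type v} [AddCommGroup N]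
    [Module A N] (x : σ → A) (j : σ) (y : N) : smulEnd N x j y = x j • y := rfl

theorem smulEnd_comm {σ : Type w} {A : Type u} [CommRing A] {N : Type v} [AddCommGroup N]
    [Module A N] (x : σ → A) (i j : σ) (y : N) :
    smulEnd N x i (smulEnd N x j y) = smulEnd N x j (smulEnd N x i y) := by
  simp only [smulEnd_apply, smul_smul, mul_comm]

end Koszul

section IntGrading

variable {k : Type u} [Field k] {M : Type v} [AddCommGroup M] [Module k M]

/-- A grading by the natural numbers, extended by zero to the integers. -/
def intGrading (ℳ : ℕ → Submodule k M) (m : ℤ) : AddSubgroup M :=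
  if 0 ≤ m then (ℳ m.toNat).toAddSubgroup else ⊥

variable {ℳ : ℕ → Submodule k M}

theorem mem_intGrading_natCast {n : ℕ} {x : M} : x ∈ intGrading ℳ n ↔ x ∈ ℳ n := by
  rw [intGrading, if_pos (Int.natCast_nonneg n)]
  rfl

theorem mem_intGrading_of_neg {m : ℤ} (hm : m < 0) {x : M} : x ∈ intGrading ℳ m ↔ x = 0 := by
  rw [intGrading, if_neg (not_le.2 hm)]
  exact AddSubgroup.mem_bot

theorem mem_intGrading_iff {m : ℤ} {x : M} :
    x ∈ intGrading ℳ m ↔ x = 0 ∨ ∃ n : ℕ, (n : ℤ) = m ∧ x ∈ ℳ n := by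
  constructor
  · intro hx
    rcases lt_or_ge m 0 with hm | hm
    · exact Or.inl ((mem_intGrading_of_neg hm).1 hx)
    · obtain ⟨n, rfl⟩ := Int.eq_ofNat_of_zero_le hm
      exact Or.inr ⟨n, rfl, mem_intGrading_natCast.1 hx⟩
  · rintro (rfl | ⟨n, rfl, hx⟩)
    · exact zero_mem _
    · exact mem_intGrading_natCast.2 hx

end IntGrading

namespace MvPolynomial

open Koszul

variable {σ : Type w} {k : Type u} [Field k] (e : σ → ℕ)

/-- The weighted grading of a polynomial ring, indexed by the integers. -/
abbrev weightedGrading (k : Type u) [Field k] (e : σ → ℕ) : ℤ → AddSubgroup (MvPolynomial σ k) :=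
  intGrading (weightedHomogeneousSubmodule k e)

/-- Division by a variable, discarding the remainder. -/
def divX (j : σ) : MvPolynomial σ k →+ MvPolynomial σ k where
  toFun p := p.divMonomial (Finsupp.single j 1)
  map_zero' := zero_divMonomial _
  map_add' p q := add_divMonomial p q _

theorem divX_X_mul (j : σ) (p : MvPolynomial σ k) : divX j (X j * p) = p :=
  X_mul_divMonomial j p

theorem divX_X_mul_of_ne {i j : σ} (h : i ≠ j) (p : MvPolynomial σ k) :
    divX j (X i * p) = X i * divX j p := by
  classical
  ext m
  change coeff m ((X i * p).divMonomial _) = coeff m (X i * p.divMonomial _)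
  rw [coeff_divMonomial, coeff_X_mul', coeff_X_mul', coeff_divMonomial]
  have hi : i ∈ (Finsupp.single j 1 + m).support ↔ i ∈ m.support := by
    simp [h.symm]
  simp only [hi]
  split_ifs with him
  · congr 1
    rw [add_tsub_assoc_of_le]
    rw [Finsupp.single_le_iff]
    exact Nat.one_le_iff_ne_zero.2 (Finsupp.mem_support_iff.1 him)
  · rfl

theorem mul_mem_weightedGrading {m n : ℤ} {p q : MvPolynomial σ k}
    (hp : p ∈ weightedGrading k e m) (hq : q ∈ weightedGrading k e n) :
    p * q ∈ weightedGrading k e (m + n) := by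
  rcases mem_intGrading_iff.1 hp with rfl | ⟨m, rfl, hp⟩
  · rw [zero_mul]
    exact zero_mem _
  rcases mem_intGrading_iff.1 hq with rfl | ⟨n, rfl, hq⟩
  · rw [mul_zero]
    exact zero_mem _
  rw [← Nat.cast_add, mem_intGrading_natCast]
  exact IsWeightedHomogeneous.mul hp hq

theorem X_mem_weightedGrading (j : σ) : (X j : MvPolynomial σ k) ∈ weightedGrading k e (e j) :=
  mem_intGrading_natCast.2 (isWeightedHomogeneous_X k e j)

theorem X_mul_mem_weightedGrading (j : σ) {n : ℤ} {p : MvPolynomial σ k}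
    (hp : p ∈ weightedGrading k e n) : X j * p ∈ weightedGrading k e (n + e j) := by
  rw [add_comm]
  exact mul_mem_weightedGrading e (X_mem_weightedGrading e j) hp

theorem divX_mem_weightedGrading (j : σ) {n : ℤ} {p : MvPolynomial σ k}
    (hp : p ∈ weightedGrading k e n) : divX j p ∈ weightedGrading k e (n - e j) := by
  rcases mem_intGrading_iff.1 hp with rfl | ⟨n, rfl, hp'⟩
  · rw [map_zero]
    exact zero_mem _
  replace hp : p.IsWeightedHomogeneous e n := hp'
  have hw : ∀ m, coeff m (divX j p) ≠ 0 → e j + Finsupp.weight e m = n := by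
    intro m hm
    have := hp (show coeff (Finsupp.single j 1 + m) p ≠ 0 by
      rwa [← coeff_divMonomial])
    simpa [map_add, Finsupp.weight_single] using this
  by_cases h0 : divX j p = 0
  · rw [h0]
    exact zero_mem _
  · obtain ⟨m, hm⟩ := ne_zero_iff.1 h0
    have := hw m hm
    have hn : (n : ℤ) - e j = ((n - e j : ℕ) : ℤ) := by omega
    rw [hn, mem_intGrading_natCast, mem_weightedHomogeneousSubmodule]
    intro m' hm'
    have := hw m' hm'
    omega

/-- The Koszul complex of distinct variables is acyclic in positive homological degrees. -/
theorem acyclic_X_of_pos {l : List σ} (hl : l.Nodup) {p : ℤ} (hp : 0 < p) (d : ℤ) :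
    Acyclic (fun j => (e j : ℤ)) (weightedGrading k e)
      (smulEnd (MvPolynomial σ k) (X : σ → MvPolynomial σ k)) l p d :=
  acyclic_of_leftInverse (δ := divX) (fun i j x => smulEnd_comm X i j x)
    (fun j x => by rw [smulEnd_apply, smul_eq_mul, divX_X_mul])
    (fun i j h x => by
      rw [smulEnd_apply, smulEnd_apply, smul_eq_mul, smul_eq_mul, divX_X_mul_of_ne h])
    (fun j n x hx => by
      rw [smulEnd_apply, smul_eq_mul]
      exact X_mul_mem_weightedGrading e j hx)
    (fun j n x hx => divX_mem_weightedGrading e j hx) hl hp d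

/-- In homological degree zero this says that a form of positive degree lies in the ideal of the
variables: each of its monomials is divisible by some variable. -/
theorem acyclic_X_zero {l : List σ} (hl : ∀ j, j ∈ l) {d : ℤ} (hd : 0 < d) :
    Acyclic (fun j => (e j : ℤ)) (weightedGrading k e)
      (smulEnd (MvPolynomial σ k) (X : σ → MvPolynomial σ k)) l 0 d := by
  rw [acyclic_zero_iff]
  intro p hp
  obtain ⟨d, rfl⟩ := Int.eq_ofNat_of_zero_le hd.le
  have hp : p.IsWeightedHomogeneous e d := mem_intGrading_natCast.1 hp
  rw [p.as_sum]
  refine sum_mem fun m hm => ?_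
  have hm0 : m ≠ 0 := by
    rintro rfl
    have := hp (mem_support_iff.1 hm)
    rw [map_zero] at this
    omega
  obtain ⟨j, hj⟩ := Finsupp.ne_iff.1 hm0
  have hmw := hp (mem_support_iff.1 hm)
  refine (le_iSup₂_of_le j (hl j) le_rfl : (weightedGrading k e ((d : ℤ) - e j)).map _ ≤ _)
    ⟨divX j (monomial m (coeff m p)), divX_mem_weightedGrading e j
      (mem_intGrading_natCast.2 (isWeightedHomogeneous_monomial e m _ hmw)), ?_⟩
  have hjm : Finsupp.single j 1 ≤ m := by
    rw [Finsupp.single_le_iff]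
    exact Nat.one_le_iff_ne_zero.2 hj
  have : (monomial m (coeff m p) : MvPolynomial σ k) =
      X j * monomial (m - Finsupp.single j 1) (coeff m p) := by
    rw [X, monomial_mul, one_mul, add_tsub_cancel_of_le hjm]
  rw [smulEnd_apply, smul_eq_mul, this, divX_X_mul]

end MvPolynomial

/-! ### Syzygies of graded modules and Koszul homology of a sequence of ring elements. -/

namespace Koszul

variable {B : Type u} [CommRing B]

/-- A grading of the ring `B`, concentrated in nonnegative degrees. -/
structure IsRingGrading (PB : ℤ → AddSubgroup B) : Prop where
  one_mem : (1 : B) ∈ PB 0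
  mul_mem : ∀ {m n b c}, b ∈ PB m → c ∈ PB n → b * c ∈ PB (m + n)
  eq_zero : ∀ {n}, n < 0 → ∀ {b}, b ∈ PB n → b = 0

/-- A grading of a module over the graded ring `B`, concentrated in nonnegative degrees. -/
structure IsModuleGrading (PB : ℤ → AddSubgroup B) {N : Type v} [AddCommGroup N] [Module B N]
    (P : ℤ → AddSubgroup N) : Prop where
  smul_mem : ∀ {m n b x}, b ∈ PB m → x ∈ P n → b • x ∈ P (m + n)
  eq_zero : ∀ {n}, n < 0 → ∀ {x}, x ∈ P n → x = 0

/-- The induced grading of a submodule. -/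
def subGrading {N : Type v} [AddCommGroup N] [Module B N] (P : ℤ → AddSubgroup N)
    (K : Submodule B N) (n : ℤ) : AddSubgroup K :=
  (P n).comap K.subtype.toAddMonoidHom

variable {PB : ℤ → AddSubgroup B} {σ : Type w} {J : Type v} {N : Type u₁} [AddCommGroup N]
  [Module B N] {P : ℤ → AddSubgroup N}

theorem mem_subGrading {K : Submodule B N} {n : ℤ} {x : K} :
    x ∈ subGrading P K n ↔ (x : N) ∈ P n := Iff.rfl

namespace IsModuleGrading

theorem smulEnd_mem (hP : IsModuleGrading PB P) {x : σ → B} {e : σ → ℤ}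
    (hx : ∀ j, x j ∈ PB (e j)) (j : σ) (n : ℤ) (y : N) (hy : y ∈ P n) :
    smulEnd N x j y ∈ P (n + e j) := by
  rw [add_comm]
  exact hP.smul_mem (hx j) hy

theorem sub (hP : IsModuleGrading PB P) (K : Submodule B N) :
    IsModuleGrading PB (subGrading P K) where
  smul_mem hb hx := hP.smul_mem hb hx
  eq_zero hn _ hx := Subtype.ext (hP.eq_zero hn hx)

theorem free (hB : IsRingGrading PB) {deg : J → ℤ} (hdeg : ∀ j, 0 ≤ deg j) :
    IsModuleGrading PB (freeGrading PB deg) where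
  smul_mem hb hx j := by
    rw [add_sub_assoc]
    exact hB.mul_mem hb (hx j)
  eq_zero {n} hn x hx := by
    ext j
    exact hB.eq_zero (by have := hdeg j; omega) (hx j)

theorem linearCombination_mem (hP : IsModuleGrading PB P) {deg : J → ℤ} {z : J → N}
    (hz : ∀ j, z j ∈ P (deg j)) {n : ℤ} {g : J →₀ B} (hg : g ∈ freeGrading PB deg n) :
    Finsupp.linearCombination B z g ∈ P n := by
  rw [Finsupp.linearCombination_apply]
  refine sum_mem fun j _ => ?_
  have := hP.smul_mem (hg j) (hz j)
  rwa [sub_add_cancel] at this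

end IsModuleGrading

theorem shortExact_ker {N' : Type v} [AddCommGroup N'] [Module B N'] {P' : ℤ → AddSubgroup N'}
    (x : σ → B) {φ : N' →ₗ[B] N} (hφ : ∀ n, ∀ g ∈ P' n, φ g ∈ P n)
    (hlift : ∀ n, ∀ y ∈ P n, ∃ g ∈ P' n, φ g = y) :
    ShortExact (subGrading P' (LinearMap.ker φ)) P' P (smulEnd _ x) (smulEnd _ x) (smulEnd _ x)
      (LinearMap.ker φ).subtype.toAddMonoidHom φ.toAddMonoidHom where
  inj := Subtype.val_injective
  comp x := x.2
  mem_ι _ _ hx := hx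
  mem_φ := hφ
  lift := hlift
  ker _ y hy h0 := ⟨⟨y, h0⟩, hy, rfl⟩
  comm_ι _ _ := rfl
  comm_φ j y := φ.map_smul (x j) y

/-- Graded Nakayama: if the Koszul homology of `N` in homological degree zero vanishes in degrees
above `t`, then `N` is generated in degrees at most `t`. -/
theorem exists_lift_of_acyclic_zero (hB : IsRingGrading PB) (hP : IsModuleGrading PB P)
    {x : σ → B} {e : σ → ℤ} (hx : ∀ j, x j ∈ PB (e j)) (he : ∀ j, 0 < e j) {l : List σ} {t : ℤ}
    (h : ∀ d, t < d → Acyclic e P (smulEnd N x) l 0 d) {deg : J → ℤ} (hdeg : ∀ j, 0 ≤ deg j)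
    {z : J → N}
    (hz : ∀ n, 0 ≤ n → n ≤ t → ∀ y ∈ P n, ∃ j, deg j = n ∧ z j = y) (n : ℤ) (y : N)
    (hy : y ∈ P n) : ∃ g ∈ freeGrading PB deg n, Finsupp.linearCombination B z g = y := by
  -- Induction on the degree through a natural upper bound `m`; negative degrees contribute only
  -- zero.
  suffices H : ∀ (m : ℕ) (n : ℤ), n < m → ∀ y ∈ P n,
      ∃ g ∈ freeGrading PB deg n, Finsupp.linearCombination B z g = y from
    H (n.toNat + 1) n (by omega) y hy
  clear hy y n
  intro m
  induction m with
  | zero =>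
    intro n hn y hy
    exact ⟨0, zero_mem _, by rw [hP.eq_zero (by simpa using hn) hy, map_zero]⟩
  | succ m ih =>
    intro n hn y hy
    rcases lt_or_ge n 0 with h0 | h0
    · exact ⟨0, zero_mem _, by rw [hP.eq_zero h0 hy, map_zero]⟩
    rcases le_or_gt n t with hnt | hnt
    · obtain ⟨j, rfl, rfl⟩ := hz n h0 hnt y hy
      refine ⟨Finsupp.single j 1, single_mem_freeGrading ?_, ?_⟩
      · rw [sub_self]
        exact hB.one_mem
      · rw [Finsupp.linearCombination_single, one_smul]
    · have hle : (⨆ i ∈ l, (P (n - e i)).map (smulEnd N x i)) ≤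
          (freeGrading PB deg n).map (Finsupp.linearCombination B z).toAddMonoidHom := by
        refine iSup₂_le fun i _ => ?_
        rintro _ ⟨y, hy, rfl⟩
        obtain ⟨g, hg, rfl⟩ := ih (n - e i) (by have := he i; push_cast at hn; omega) y hy
        refine ⟨x i • g, ?_, (Finsupp.linearCombination B z).map_smul _ _⟩
        have := (IsModuleGrading.free hB hdeg).smul_mem (hx i) hg
        rwa [add_sub_cancel] at this
      exact hle (acyclic_zero_iff.1 (h n hnt) hy)

variable {x : σ → B} {e : σ → ℤ} {l : List σ}

/-- Koszul homology of the kernel of a graded surjection from a free module. -/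
theorem acyclic_ker (hB : IsRingGrading PB) (hx : ∀ j, x j ∈ PB (e j))
    (hpos : ∀ p, 0 < p → ∀ d, Acyclic e PB (smulEnd B x) l p d)
    (hzero : ∀ d, 0 < d → Acyclic e PB (smulEnd B x) l 0 d)
    {deg : J → ℤ} (hdeg0 : ∀ j, 0 ≤ deg j) {t : ℕ → ℤ} (ht : Monotone t)
    (hdeg : ∀ j, deg j ≤ t 0) {φ : (J →₀ B) →ₗ[B] N}
    (hφ : ∀ n, ∀ g ∈ freeGrading PB deg n, φ g ∈ P n)
    (hlift : ∀ n, ∀ y ∈ P n, ∃ g ∈ freeGrading PB deg n, φ g = y)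
    (hN : ∀ (s : ℕ) (d : ℤ), t s < d → Acyclic e P (smulEnd N x) l s d) (s : ℕ) (d : ℤ)
    (hd : t (s + 1) < d) :
    Acyclic e (subGrading (freeGrading PB deg) (LinearMap.ker φ)) (smulEnd _ x) l s d := by
  refine (shortExact_ker x hφ hlift).acyclic_left
    ((IsModuleGrading.free hB hdeg0).smulEnd_mem hx) (smulEnd_comm x)
    (acyclic_free (a := smulEnd B x) (fun i g j => rfl) fun j => ?_)
    (by exact_mod_cast hN (s + 1) d hd)
  -- The free module has Koszul homology only in homological degree zero, and there only in the
  -- degrees of its generators, which are at most t 0 ≤ t 1 < d.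
  rcases Nat.eq_zero_or_pos s with rfl | hs
  · have := hdeg j
    have := ht (Nat.zero_le (0 + 1))
    exact hzero _ (by omega)
  · exact hpos _ (by exact_mod_cast hs) _

/-- Bounds for the Koszul homology of `f` with coefficients in `N`, in terms of bounds for the
Koszul homology of `f` with coefficients in `B` and the degrees `t s` of the syzygies of `N`. -/
theorem acyclic_of_syzygies {τ : Type w} {f : τ → B} {e' : τ → ℤ} {l' : List τ}
    (hB : IsRingGrading PB) (hx : ∀ j, x j ∈ PB (e j)) (he : ∀ j, 0 < e j)
    (hpos : ∀ p, 0 < p → ∀ d, Acyclic e PB (smulEnd B x) l p d)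
    (hzero : ∀ d, 0 < d → Acyclic e PB (smulEnd B x) l 0 d)
    (hf : ∀ j, f j ∈ PB (e' j)) (p : ℕ) (N : Type u) [AddCommGroup N] [Module B N]
    (P : ℤ → AddSubgroup N) (hP : IsModuleGrading PB P) (t : ℕ → ℤ) (ht : Monotone t)
    (hN : ∀ (s : ℕ) (d : ℤ), t s < d → Acyclic e P (smulEnd N x) l s d) (d : ℤ)
    (hd : ∀ q ≤ p, ∀ c ≤ t (p - q), Acyclic e' PB (smulEnd B f) l' q (d - c)) :
    Acyclic e' P (smulEnd N f) l' p d := by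
  induction p generalizing N t with
  | zero =>
    -- Every homogeneous element of degree at most `t 0` serves as a generator. Minimality is
    -- irrelevant: only the degrees of the generators enter the bounds.
    let J := {y : ℤ × N // 0 ≤ y.1 ∧ y.1 ≤ t 0 ∧ y.2 ∈ P y.1}
    let deg : J → ℤ := fun j => j.1.1
    have hφ : ∀ n, ∀ g ∈ freeGrading PB deg n,
        Finsupp.linearCombination B (fun j : J => j.1.2) g ∈ P n := fun n g hg =>
      hP.linearCombination_mem (fun j => j.2.2.2) hg
    have hlift := exists_lift_of_acyclic_zero hB hP hx he (hN 0) (deg := deg)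
      (fun j => j.2.1) (z := fun j : J => j.1.2)
      (fun n h0 hn y hy => ⟨⟨(n, y), h0, hn, hy⟩, rfl, rfl⟩)
    have S := shortExact_ker f hφ hlift
    refine S.acyclic_right ((IsModuleGrading.free hB fun j => j.2.1).smulEnd_mem hf)
      (acyclic_free (a := smulEnd B f) (fun i g j => rfl) fun j => hd 0 le_rfl _ j.2.2.1) ?_
    exact fun u hu hv => S.exists_bd_of_acyclic (smulEnd_comm f) (acyclic_of_neg (by norm_num))
      hu hv
  | succ p ih =>
    let J := {y : ℤ × N // 0 ≤ y.1 ∧ y.1 ≤ t 0 ∧ y.2 ∈ P y.1}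
    let deg : J → ℤ := fun j => j.1.1
    have hφ : ∀ n, ∀ g ∈ freeGrading PB deg n,
        Finsupp.linearCombination B (fun j : J => j.1.2) g ∈ P n := fun n g hg =>
      hP.linearCombination_mem (fun j => j.2.2.2) hg
    have hlift := exists_lift_of_acyclic_zero hB hP hx he (hN 0) (deg := deg)
      (fun j => j.2.1) (z := fun j : J => j.1.2)
      (fun n h0 hn y hy => ⟨⟨(n, y), h0, hn, hy⟩, rfl, rfl⟩)
    have S := shortExact_ker f hφ hlift
    refine S.acyclic_right ((IsModuleGrading.free hB fun j => j.2.1).smulEnd_mem hf)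
      (acyclic_free (a := smulEnd B f) (fun i g j => rfl) fun j =>
        hd (p + 1) le_rfl _ (by simpa using j.2.2.1)) ?_
    intro u hu hv
    refine S.exists_bd_of_acyclic (smulEnd_comm f) ?_ hu hv
    rw [show ((p + 1 : ℕ) : ℤ) - 1 = p by push_cast; ring]
    -- Dimension shift: the kernel of the cover has the syzygy bounds of `N`, shifted by one.
    refine ih _ _ ((IsModuleGrading.free hB fun j => j.2.1).sub _) (fun s => t (s + 1))
      (fun a b hab => ht (by omega))
      (acyclic_ker hB hx hpos hzero (fun j => j.2.1) ht (fun j => j.2.2.1) hφ hlift hN) ?_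
    intro q hq c hc
    exact hd q (by omega) c (by rwa [show p + 1 - q = p - q + 1 by omega])

/-- Bounds for the Koszul homology of homogeneous generators `f` of an ideal `I` that contains all
elements of degree at least `τ`, in terms of the degrees `t s` of the syzygies of `I`. -/
theorem acyclic_of_ideal {r : ℕ} {f : Fin r → B} {e' : Fin r → ℤ} {l' : List (Fin r)}
    {σ : Type} {x : σ → B} {e : σ → ℤ} {l : List σ}
    (hB : IsRingGrading PB) (hx : ∀ j, x j ∈ PB (e j)) (he : ∀ j, 0 < e j)
    (hpos : ∀ p, 0 < p → ∀ d, Acyclic e PB (smulEnd B x) l p d)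
    (hzero : ∀ d, 0 < d → Acyclic e PB (smulEnd B x) l 0 d)
    (hf : ∀ j, f j ∈ PB (e' j)) (hl' : ∀ j, j ∈ l') (he0 : ∀ j, 0 ≤ e' j) {I : Ideal B}
    (hfI : ∀ j, f j ∈ I)
    (hI : ∀ n, ∀ y ∈ PB n, y ∈ I →
      ∃ g ∈ freeGrading PB e' n, Finsupp.linearCombination B f g = y)
    {τ : ℤ} (hτ : ∀ n, τ ≤ n → ∀ b ∈ PB n, b ∈ I) (heτ : ∀ j, e' j ≤ τ)
    {t : ℕ → ℤ} (ht : Monotone t) (ht0 : t 0 = τ)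
    (hN : ∀ (s : ℕ) (d : ℤ), t s < d → Acyclic e (subGrading PB I) (smulEnd I x) l s d)
    {β : ℕ → ℤ} (hβ : ∀ q : ℕ, (q + 1) * τ ≤ β q)
    (hβt : ∀ p q, p < q → β p + t (q - p) ≤ β q) (q : ℕ) (d : ℤ) (hd : β q ≤ d) :
    Acyclic e' PB (smulEnd B f) l' q d := by
  induction q using Nat.strong_induction_on generalizing d with
  | _ q ih =>
  intro z hz h0
  let F : Fin r → I := fun j => ⟨f j, hfI j⟩
  have hPI : IsModuleGrading PB (subGrading PB I) :=
    IsModuleGrading.sub ⟨hB.mul_mem, hB.eq_zero⟩ I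
  have hval : ∀ g : Fin r →₀ B,
      (Finsupp.linearCombination B F g : B) = Finsupp.linearCombination B f g := by
    intro g
    simp only [Finsupp.linearCombination_apply, Finsupp.sum, Submodule.coe_sum,
      Submodule.coe_smul, F]
  have hφ : ∀ n, ∀ g ∈ freeGrading PB e' n,
      Finsupp.linearCombination B F g ∈ subGrading PB I n := fun n g hg =>
    hPI.linearCombination_mem (fun j => hf j) hg
  have hlift : ∀ n, ∀ y ∈ subGrading PB I n, ∃ g ∈ freeGrading PB e' n,
      Finsupp.linearCombination B F g = y := fun n y hy => by
    obtain ⟨g, hg, hgy⟩ := hI n y hy y.2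
    exact ⟨g, hg, Subtype.ext ((hval g).trans hgy)⟩
  have S := shortExact_ker f hφ hlift
  have hfree := IsModuleGrading.free hB he0
  -- the coefficients of `z` lie in the ideal
  let Q : ℤ → AddSubgroup B := fun n => PB n ⊓ I.toAddSubgroup
  have hQ : ∀ n, (d : ℤ) - q * τ ≤ n → PB n ≤ Q n := fun n hn b hb => by
    refine ⟨hb, hτ n ?_ b hb⟩
    have := hβ q
    linarith
  have hQI : ∀ n, ∀ b ∈ Q n, ∃ c ∈ subGrading PB I n, I.subtype.toAddMonoidHom c = b :=
    fun n b hb => ⟨⟨b, hb.2⟩, hb.1, rfl⟩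
  -- The weights are at most τ, so the coefficients of a q-chain have degree at least d - qτ, which
  -- is at least τ because d ≥ β q ≥ (q+1)τ.
  obtain ⟨y, hy, rfl⟩ := exists_lift hQI l' (piece_le_piece heτ l' hQ hz)
  have hy0 : bd (smulEnd I f) l' y = 0 := by
    refine map_injective (φ := I.subtype.toAddMonoidHom) Subtype.val_injective l' ?_
    rw [← bd_map (a' := smulEnd B f) l' (fun j _ x => rfl), h0, map_zero]
  -- it lifts to a cycle in the free module on `f`
  obtain ⟨g, hg, hg0, rfl⟩ := S.exists_cycle_lift (hfree.smulEnd_mem hf) (fun u hu hv => by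
    refine S.exists_bd_of_acyclic (smulEnd_comm f) ?_ hu hv
    rcases Nat.eq_zero_or_pos q with rfl | hq
    · exact acyclic_of_neg (by norm_num)
    rw [show (q : ℤ) - 1 = (q - 1 : ℕ) by omega]
    -- The obstruction lies in homological degree q - 1 for the first syzygies of `I`. Here c ≤ t (q
    -- - p) and `hβt` give d - c ≥ β p, the range of the induction hypothesis.
    refine acyclic_of_syzygies hB hx he hpos hzero hf (q - 1) _ _ (hfree.sub _)
      (fun s => t (s + 1)) (fun a b hab => ht (by omega))
      (acyclic_ker hB hx hpos hzero he0 ht (fun j => (heτ j).trans_eq ht0.symm) hφ hlift hN)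
      d ?_
    intro p hp c hc
    have h1 := hβt p q (by omega)
    rw [show q - 1 - p + 1 = q - p by omega] at hc
    exact ih p (by omega) _ (by omega)) hy hy0
  obtain ⟨s, hs⟩ := exists_eq_sum_map_single l' g
  -- Each coordinate of the lifted cycle is a cycle over `B`, so f_j times it is a boundary by the
  -- null homotopy.
  have hw : ∀ j, ∃ w ∈ piece e' PB l' (q + 1) d, bd (smulEnd B f) l' w =
      map (smulEnd B f j) l' (map (Finsupp.applyAddHom j) l' g) := by
    intro j
    have := exists_bd_eq_map (smulEnd B f) l' (hl' j) (map_mem_piece_shift (e := e')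
      (P := freeGrading PB e') (P' := PB) (φ := Finsupp.applyAddHom j) (c := -e' j)
      (fun n x hx => hx j) l' hg)
      (by rw [bd_map (a := smulEnd _ f) l' (fun i _ x => rfl), hg0, map_zero])
    rwa [neg_add_cancel_right] at this
  choose w hw1 hw2 using hw
  refine ⟨∑ j ∈ s, w j, sum_mem fun j _ => hw1 j, ?_⟩
  conv_rhs => rw [hs s subset_rfl]
  simp only [map_sum, hw2, map_map]
  refine Finset.sum_congr rfl fun j _ => congrArg (fun χ => map χ l' g)
    (AddMonoidHom.ext fun y => ?_)
  change f j • y j = ((Finsupp.linearCombination B F (Finsupp.single j (y j)) : I) : B)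
  rw [hval, Finsupp.linearCombination_single, smul_eq_mul, smul_eq_mul, mul_comm]

end Koszul

/-! ### Homogeneous components, and the irrelevant ideal of a polynomial ring. -/

open Koszul MvPolynomial

/-- The projections of a graded group onto its homogeneous parts. -/
structure GradedProj {N : Type u} [AddCommGroup N] (P : ℤ → AddSubgroup N) where
  proj : ℤ → N →+ N
  mem : ∀ n x, proj n x ∈ P n
  same : ∀ n, ∀ x ∈ P n, proj n x = x
  ne : ∀ m n, m ≠ n → ∀ x ∈ P m, proj n x = 0
  exists_sum : ∀ x, ∃ s : Finset ℤ, ∀ t, s ⊆ t → x = ∑ n ∈ t, proj n x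

namespace GradedProj

variable {N : Type u} [AddCommGroup N] {P : ℤ → AddSubgroup N}
  {N' : Type v} [AddCommGroup N'] {P' : ℤ → AddSubgroup N'}

theorem map_proj_shift (π : GradedProj P) (π' : GradedProj P') {φ : N →+ N'} {c : ℤ}
    (hφ : ∀ n, ∀ x ∈ P n, φ x ∈ P' (n + c)) (n : ℤ) (x : N) :
    φ (π.proj n x) = π'.proj (n + c) (φ x) := by
  classical
  obtain ⟨s, hs⟩ := π.exists_sum x
  have hx := hs (insert n s) (Finset.subset_insert n s)
  conv_rhs => rw [hx]
  rw [map_sum, map_sum, Finset.sum_eq_single n]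
  · exact (π'.same _ _ (hφ _ _ (π.mem n x))).symm
  · exact fun m _ hm => π'.ne (m + c) _ (fun h => hm (add_right_cancel h)) _ (hφ _ _ (π.mem m x))
  · exact fun h => absurd (Finset.mem_insert_self n s) h

theorem map_proj (π : GradedProj P) (π' : GradedProj P') {φ : N →+ N'}
    (hφ : ∀ n, ∀ x ∈ P n, φ x ∈ P' n) (n : ℤ) (x : N) :
    φ (π.proj n x) = π'.proj n (φ x) := by
  have := π.map_proj_shift π' (c := 0) (φ := φ)
    (fun n x hx => by rw [add_zero]; exact hφ n x hx) n x
  rwa [add_zero] at this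

/-- A preimage need not be homogeneous, but its component of degree `n` has the same image. This
turns plain surjectivity, as in the definition of a resolution, into surjectivity in each degree. -/
theorem exists_lift (π : GradedProj P) (π' : GradedProj P') {φ : N →+ N'}
    (hφ : ∀ n, ∀ x ∈ P n, φ x ∈ P' n) {n : ℤ} {y : N'} (hy : y ∈ P' n) (h : ∃ x, φ x = y) :
    ∃ x ∈ P n, φ x = y := by
  obtain ⟨x, rfl⟩ := h
  exact ⟨π.proj n x, π.mem n x, by rw [π.map_proj π' hφ, π'.same n _ hy]⟩

/-- The projections of a subgroup that is closed under taking homogeneous components. -/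
def ofInjective (π' : GradedProj P') (ι : N →+ N') (hι : Function.Injective ι)
    (hP : ∀ n x, x ∈ P n ↔ ι x ∈ P' n) (h : ∀ n x, ∃ y, ι y = π'.proj n (ι x)) :
    GradedProj P where
  proj n :=
    { toFun := fun x => (h n x).choose
      map_zero' := hι (by rw [(h n 0).choose_spec, map_zero, map_zero])
      map_add' := fun x y => hι ((h n (x + y)).choose_spec.trans (by
        rw [map_add ι, map_add ι, map_add, (h n x).choose_spec, (h n y).choose_spec])) }
  mem n x := (hP n _).2 (by
    change ι (h n x).choose ∈ _
    rw [(h n x).choose_spec]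
    exact π'.mem _ _)
  same n x hx := hι ((h n x).choose_spec.trans (π'.same n _ ((hP n x).1 hx)))
  ne m n hmn x hx := hι ((h n x).choose_spec.trans (by
    rw [π'.ne m n hmn _ ((hP m x).1 hx), map_zero]))
  exists_sum x := by
    obtain ⟨s, hs⟩ := π'.exists_sum (ι x)
    refine ⟨s, fun t ht => hι ?_⟩
    rw [map_sum]
    refine (hs t ht).trans (Finset.sum_congr rfl fun n _ => ?_)
    exact (h n x).choose_spec.symm

/-- The projections of a graded free module. -/
def free {J : Type v} (π : GradedProj P) (deg : J → ℤ) : GradedProj (freeGrading P deg) where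
  proj n :=
    { toFun := fun g => Finsupp.onFinset g.support (fun j => π.proj (n - deg j) (g j))
        fun j hj => Finsupp.mem_support_iff.2 fun h => hj (by rw [h, map_zero])
      map_zero' := by ext j; simp
      map_add' := fun g h => by ext j; simp }
  mem n g j := π.mem _ _
  same n g hg := by
    ext j
    exact π.same _ _ (hg j)
  ne m n hmn g hg := by
    ext j
    exact π.ne (m - deg j) _ (fun h => hmn (by omega)) _ (hg j)
  exists_sum g := by
    classical
    choose s hs using fun j => π.exists_sum (g j)
    refine ⟨g.support.biUnion fun j => (s j).image (· + deg j), fun t ht => ?_⟩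
    ext j
    rw [Finsupp.finsetSum_apply]
    change g j = ∑ n ∈ t, π.proj (n - deg j) (g j)
    by_cases hj : g j = 0
    · simp [hj]
    · have hst : s j ⊆ t.image (· - deg j) := by
        intro n hn
        refine Finset.mem_image.2 ⟨n + deg j, ht ?_, by ring⟩
        exact Finset.mem_biUnion.2
          ⟨j, Finsupp.mem_support_iff.2 hj, Finset.mem_image_of_mem _ hn⟩
      refine (hs j _ hst).trans (Finset.sum_image ?_)
      intro a _ b _ hab
      exact sub_left_injective hab

end GradedProj

section

variable {σ : Type} {k : Type u} [Field k] (e : σ → ℕ)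

/-- The projections of a polynomial ring onto its weighted homogeneous parts. -/
def weightedProj (k : Type u) [Field k] (e : σ → ℕ) : GradedProj (weightedGrading k e) where
  proj m := if 0 ≤ m then (weightedHomogeneousComponent e m.toNat).toAddMonoidHom else 0
  mem m p := by
    split_ifs with hm
    · obtain ⟨n, rfl⟩ := Int.eq_ofNat_of_zero_le hm
      exact mem_intGrading_natCast.2 (weightedHomogeneousComponent_mem e p n)
    · exact zero_mem _
  same m p hp := by
    rcases mem_intGrading_iff.1 hp with rfl | ⟨n, rfl, hp'⟩
    · rw [map_zero]
    · rw [if_pos (Int.natCast_nonneg n)]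
      exact IsWeightedHomogeneous.weightedHomogeneousComponent_same hp'
  ne m n hmn p hp := by
    rcases mem_intGrading_iff.1 hp with rfl | ⟨m, rfl, hp'⟩
    · rw [map_zero]
    · split_ifs with hn
      · exact IsWeightedHomogeneous.weightedHomogeneousComponent_ne _ hp' (by omega)
      · rfl
  exists_sum p := by
    classical
    refine ⟨p.support.image fun m => (Finsupp.weight e m : ℤ), fun t ht => ?_⟩
    ext m
    rw [coeff_sum]
    by_cases hm : coeff m p = 0
    · rw [hm, Finset.sum_eq_zero]
      intro n _
      split_ifs
      · change coeff m (weightedHomogeneousComponent e n.toNat p) = 0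
        rw [coeff_weightedHomogeneousComponent]
        split_ifs
        · exact hm
        · rfl
      · exact coeff_zero m
    · have hmt := ht (Finset.mem_image_of_mem _ (mem_support_iff.2 hm))
      rw [Finset.sum_eq_single _ _ (fun h => absurd hmt h)]
      · rw [if_pos (Int.natCast_nonneg _)]
        change _ = coeff m (weightedHomogeneousComponent e _ p)
        rw [coeff_weightedHomogeneousComponent, Int.toNat_natCast, if_pos rfl]
      · intro n _ hn
        split_ifs with h0
        · change coeff m (weightedHomogeneousComponent e n.toNat p) = 0
          rw [coeff_weightedHomogeneousComponent, if_neg]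
          omega
        · exact coeff_zero m

theorem isRingGrading_weightedGrading : IsRingGrading (weightedGrading k e) where
  one_mem := by
    rw [← Nat.cast_zero, mem_intGrading_natCast]
    exact isWeightedHomogeneous_one k e
  mul_mem := mul_mem_weightedGrading e
  eq_zero hn _ hb := (mem_intGrading_of_neg hn).1 hb

theorem proj_smul_X {N : Type v} [AddCommGroup N] [Module (MvPolynomial σ k) N]
    {P : ℤ → AddSubgroup N} (hP : IsModuleGrading (weightedGrading k e) P) (π : GradedProj P)
    (j : σ) (n : ℤ) (x : N) :
    π.proj n ((X j : MvPolynomial σ k) • x) = (X j : MvPolynomial σ k) • π.proj (n - e j) x := by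
  have := π.map_proj_shift π (φ := smulEnd N (X : σ → MvPolynomial σ k) j) (c := e j)
    (hP.smulEnd_mem (X_mem_weightedGrading e) j) (n - e j) x
  rw [sub_add_cancel] at this
  exact this.symm

variable {e}

theorem positiveIdeal_eq (he : ∀ j, 0 < e j) [Fintype σ] :
    positiveIdeal (weightedHomogeneousSubmodule k e) =
      Ideal.span (Set.range (X : σ → MvPolynomial σ k)) := by
  apply le_antisymm
  · refine Ideal.span_le.2 ?_
    rintro p ⟨n, hn, hp⟩
    have h := acyclic_zero_iff.1 (acyclic_X_zero (k := k) e (l := Finset.univ.toList)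
      (fun j => by simp) (d := n) (by exact_mod_cast hn)) (mem_intGrading_natCast.2 hp)
    have hle : (⨆ i ∈ Finset.univ.toList, (weightedGrading k e ((n : ℤ) - e i)).map
        (smulEnd (MvPolynomial σ k) (X : σ → MvPolynomial σ k) i)) ≤
        (Ideal.span (Set.range (X : σ → MvPolynomial σ k))).toAddSubgroup := by
      refine iSup₂_le fun i _ => ?_
      rintro _ ⟨y, -, rfl⟩
      exact Ideal.mul_mem_right _ _ (Ideal.subset_span ⟨i, rfl⟩)
    exact hle h
  · refine Ideal.span_le.2 ?_
    rintro _ ⟨j, rfl⟩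
    exact Ideal.subset_span ⟨e j, he j, isWeightedHomogeneous_X k e j⟩

variable {N : Type v} [AddCommGroup N] [Module (MvPolynomial σ k) N] {P : ℤ → AddSubgroup N}

/-- A homogeneous element of `A₊ N` is a combination of the variables with homogeneous
coefficients. -/
theorem mem_iSup_of_mem_positiveIdeal_smul [Fintype σ] (he : ∀ j, 0 < e j)
    (hP : IsModuleGrading (weightedGrading k e) P) (π : GradedProj P) {l : List σ}
    (hl : ∀ j, j ∈ l) {d : ℤ} {y : N} (hy : y ∈ P d)
    (hy' : y ∈ positiveIdeal (weightedHomogeneousSubmodule k e) •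
      (⊤ : Submodule (MvPolynomial σ k) N)) :
    y ∈ ⨆ i ∈ l, (P (d - e i)).map (smulEnd N (X : σ → MvPolynomial σ k) i) := by
  rw [positiveIdeal_eq he] at hy'
  -- Membership in A₊N comes with arbitrary coefficients. Projecting to degree `d` makes them
  -- homogeneous.
  let T : AddSubgroup N := (⨆ i ∈ l, (P (d - e i)).map
    (smulEnd N (X : σ → MvPolynomial σ k) i)).comap (π.proj d)
  suffices h : y ∈ T by
    rwa [AddSubgroup.mem_comap, π.same d y hy] at h
  refine Submodule.smul_induction_on hy' (fun r hr x _ => ?_) fun x y hx hy => add_mem hx hy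
  induction hr using Submodule.span_induction generalizing x with
  | mem r hr =>
    obtain ⟨j, rfl⟩ := hr
    rw [AddSubgroup.mem_comap, proj_smul_X e hP]
    exact (le_iSup₂_of_le j (hl j) le_rfl : (P (d - e j)).map _ ≤ _)
      ⟨_, π.mem _ _, rfl⟩
  | zero =>
    rw [zero_smul]
    exact zero_mem _
  | add r s _ _ hr hs =>
    rw [add_smul]
    exact add_mem (hr x trivial) (hs x trivial)
  | smul a r _ hr =>
    rw [smul_eq_mul, mul_comm, mul_smul]
    exact hr _ trivial

theorem X_smul_mem_positiveIdeal_smul (he : ∀ j, 0 < e j) (j : σ) (y : N) :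
    (X j : MvPolynomial σ k) • y ∈ positiveIdeal (weightedHomogeneousSubmodule k e) •
      (⊤ : Submodule (MvPolynomial σ k) N) :=
  Submodule.smul_mem_smul (Ideal.subset_span ⟨e j, he j, isWeightedHomogeneous_X k e j⟩) trivial

theorem mem_freePiece_iff {J : Type v} {deg : J → ℕ} {n : ℕ} {x : J →₀ MvPolynomial σ k} :
    x ∈ freePiece (weightedHomogeneousSubmodule k e) deg n ↔
      x ∈ freeGrading (weightedGrading k e) (fun j => (deg j : ℤ)) n := by
  refine forall_congr' fun j => ?_
  split_ifs with h
  · rw [← Nat.cast_sub h, mem_intGrading_natCast]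
  · rw [mem_intGrading_of_neg (sub_neg.2 (Nat.cast_lt.2 (not_le.1 h))), Submodule.mem_bot]

end

/-! ### Comparison of Tor, computed from a resolution, with Koszul homology of the variables. -/

namespace GradedFreeResolution

section

variable {σ : Type} {k : Type u} [Field k] {e : σ → ℕ} {M : Type u} [AddCommGroup M] [Module k M]
  [Module (MvPolynomial σ k) M] {ℳ : ℕ → Submodule k M}
  (F : GradedFreeResolution (weightedHomogeneousSubmodule k e) ℳ)

/-- The integer grading of the terms of the resolution. -/
abbrev grading (i : ℕ) : ℤ → AddSubgroup (F.J i →₀ MvPolynomial σ k) :=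
  freeGrading (weightedGrading k e) fun j => (F.deg i j : ℤ)

theorem isModuleGrading_grading (i : ℕ) :
    IsModuleGrading (weightedGrading k e) (F.grading i) :=
  IsModuleGrading.free (isRingGrading_weightedGrading e) fun _ => Int.natCast_nonneg _

/-- The projections of the terms of the resolution. -/
def gradedProj (i : ℕ) : GradedProj (F.grading i) := (weightedProj k e).free _

theorem d_mem_grading (i : ℕ) (n : ℤ) (x) (hx : x ∈ F.grading (i + 1) n) :
    F.d i x ∈ F.grading i n := by
  rcases lt_or_ge n 0 with hn | hn
  · rw [(F.isModuleGrading_grading (i + 1)).eq_zero hn hx, map_zero]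
    exact zero_mem _
  · obtain ⟨n, rfl⟩ := Int.eq_ofNat_of_zero_le hn
    exact mem_freePiece_iff.1 (F.d_graded i n x (mem_freePiece_iff.2 hx))

theorem ε_mem_grading (n : ℤ) (x) (hx : x ∈ F.grading 0 n) : F.ε x ∈ intGrading ℳ n := by
  rcases lt_or_ge n 0 with hn | hn
  · rw [(F.isModuleGrading_grading 0).eq_zero hn hx, map_zero]
    exact zero_mem _
  · obtain ⟨n, rfl⟩ := Int.eq_ofNat_of_zero_le hn
    exact mem_intGrading_natCast.2 (F.ε_graded n x (mem_freePiece_iff.2 hx))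

/-- The grading of the first syzygy module. -/
def syzygyPiece (n : ℕ) : Submodule k (LinearMap.ker F.ε) where
  carrier := {x | (x : F.J 0 →₀ MvPolynomial σ k) ∈
    freePiece (weightedHomogeneousSubmodule k e) (F.deg 0) n}
  zero_mem' := fun _ => zero_mem _
  add_mem' := fun hx hy j => add_mem (hx j) (hy j)
  smul_mem' := fun c _ hx j => Submodule.smul_mem _ c (hx j)

/-- The integer grading of the first syzygy module. -/
abbrev syzygyGrading : ℤ → AddSubgroup (LinearMap.ker F.ε) :=
  intGrading (M := LinearMap.ker F.ε) F.syzygyPiece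

theorem mem_syzygyGrading (n : ℤ) (x : LinearMap.ker F.ε) :
    x ∈ F.syzygyGrading n ↔ (x : F.J 0 →₀ MvPolynomial σ k) ∈ F.grading 0 n := by
  rcases lt_or_ge n 0 with hn | hn
  · rw [mem_intGrading_of_neg hn]
    constructor
    · rintro rfl
      exact zero_mem _
    · exact fun hx => Subtype.ext ((F.isModuleGrading_grading 0).eq_zero hn hx)
  · obtain ⟨n, rfl⟩ := Int.eq_ofNat_of_zero_le hn
    exact mem_intGrading_natCast.trans mem_freePiece_iff

theorem syzygyGrading_eq :
    F.syzygyGrading = subGrading (F.grading 0) (LinearMap.ker F.ε) :=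
  funext fun n => AddSubgroup.ext (F.mem_syzygyGrading n)

/-- The first differential, as a map onto the first syzygy module. -/
def toSyzygy : (F.J 1 →₀ MvPolynomial σ k) →ₗ[MvPolynomial σ k] LinearMap.ker F.ε :=
  (F.d 0).codRestrict _ fun x => F.exact_zero.apply_apply_eq_zero x

theorem toSyzygy_surjective : Function.Surjective F.toSyzygy := fun y => by
  obtain ⟨x, hx⟩ := (F.exact_zero y).1 y.2
  exact ⟨x, Subtype.ext hx⟩

theorem toSyzygy_eq_zero_iff (x) : F.toSyzygy x = 0 ↔ F.d 0 x = 0 := by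
  rw [← Subtype.coe_inj]
  rfl

/-- The resolution of the first syzygy module. -/
def tail : GradedFreeResolution (M := LinearMap.ker F.ε) (weightedHomogeneousSubmodule k e)
    F.syzygyPiece where
  J i := F.J (i + 1)
  deg i := F.deg (i + 1)
  d i := F.d (i + 1)
  ε := F.toSyzygy
  d_graded i := F.d_graded (i + 1)
  ε_graded := F.d_graded 0
  ε_surjective := F.toSyzygy_surjective
  exact_zero x := (F.toSyzygy_eq_zero_iff x).trans (F.exact_succ 0 x)
  exact_succ i := F.exact_succ (i + 1)

/-- The projections of the first syzygy module. -/
def syzygyProj (π : GradedProj (intGrading ℳ)) : GradedProj F.syzygyGrading :=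
  (F.gradedProj 0).ofInjective (LinearMap.ker F.ε).subtype.toAddMonoidHom Subtype.val_injective
    F.mem_syzygyGrading fun n x => ⟨⟨(F.gradedProj 0).proj n x, by
      have := (F.gradedProj 0).map_proj π (φ := F.ε.toAddMonoidHom) F.ε_mem_grading n x
      refine LinearMap.mem_ker.2 (this.trans ?_)
      rw [show F.ε.toAddMonoidHom x = 0 from x.2, map_zero]⟩, rfl⟩

theorem isModuleGrading_syzygy :
    IsModuleGrading (weightedGrading k e) F.syzygyGrading := by
  rw [syzygyGrading_eq]
  exact (F.isModuleGrading_grading 0).sub _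

theorem shortExact_syzygy (π : GradedProj (intGrading ℳ)) :
    ShortExact F.syzygyGrading (F.grading 0) (intGrading ℳ)
      (smulEnd (LinearMap.ker F.ε) (X : σ → MvPolynomial σ k))
      (smulEnd (F.J 0 →₀ MvPolynomial σ k) (X : σ → MvPolynomial σ k))
      (smulEnd M (X : σ → MvPolynomial σ k))
      (LinearMap.ker F.ε).subtype.toAddMonoidHom F.ε.toAddMonoidHom := by
  rw [syzygyGrading_eq]
  exact shortExact_ker X F.ε_mem_grading fun n y hy =>
    (F.gradedProj 0).exists_lift π (φ := F.ε.toAddMonoidHom) F.ε_mem_grading hy (F.ε_surjective y)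

theorem acyclic_grading {l : List σ} (hl : l.Nodup) (i : ℕ) {p : ℤ} (hp : 0 < p) (d : ℤ) :
    Acyclic (fun j => (e j : ℤ)) (F.grading i) (smulEnd _ (X : σ → MvPolynomial σ k)) l p d :=
  acyclic_free (a := smulEnd (MvPolynomial σ k) X) (fun _ _ _ => rfl)
    fun _ => acyclic_X_of_pos e hl hp _

/-- Combinations of the variables with coefficients in `M` come from `A₊ F₀`. -/
theorem iSup_le_map_ε (he : ∀ j, 0 < e j) (P : ℤ → AddSubgroup M) (l : List σ) (d : ℤ) :
    (⨆ i ∈ l, (P (d - e i)).map (smulEnd M (X : σ → MvPolynomial σ k) i)) ≤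
      (positiveIdeal (weightedHomogeneousSubmodule k e) •
        (⊤ : Submodule (MvPolynomial σ k) (F.J 0 →₀ MvPolynomial σ k))).toAddSubgroup.map
          F.ε.toAddMonoidHom := by
  refine iSup₂_le fun i _ => ?_
  rintro _ ⟨y, -, rfl⟩
  obtain ⟨x, rfl⟩ := F.ε_surjective y
  exact ⟨(X i : MvPolynomial σ k) • x, X_smul_mem_positiveIdeal_smul he i x, F.ε.map_smul _ _⟩

/-- If `M` is A₊M in degree `d`, then ε z = ε w for some w in A₊F₀, and z - w is in the image of F₁.
-/
theorem mem_boundaries_zero (he : ∀ j, 0 < e j) {l : List σ} {d : ℕ}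
    (h : Acyclic (fun j => (e j : ℤ)) (intGrading ℳ) (smulEnd M (X : σ → MvPolynomial σ k)) l 0 d)
    {z} (hz : z ∈ freePiece (weightedHomogeneousSubmodule k e) (F.deg 0) d) :
    z ∈ F.boundaries 0 := by
  have hz' := F.ε_mem_grading d z (mem_freePiece_iff.1 hz)
  obtain ⟨w, hw, hwz⟩ := F.iSup_le_map_ε he _ l d (acyclic_zero_iff.1 h hz')
  have hker : F.ε (z - w) = 0 := by
    rw [map_sub, sub_eq_zero]
    exact hwz.symm
  rw [← add_sub_cancel w z]
  exact Submodule.add_mem_sup hw ((F.exact_zero _).1 hker)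

variable [Fintype σ]

/-- Let Z be the kernel of `ε`. A cycle has d z in A₊F₀ ∩ Z, so d z is a degree-zero Koszul chain of
Z that bounds over F₀. Because H₁ of `M` vanishes, it bounds over Z already, that is, d z lies in
A₊Z. Hence `z` is in A₊F₁ modulo the kernel of `d`. -/
theorem mem_boundaries_one (he : ∀ j, 0 < e j) (π : GradedProj (intGrading ℳ)) {l : List σ}
    (hl : ∀ j, j ∈ l) {d : ℕ}
    (h : Acyclic (fun j => (e j : ℤ)) (intGrading ℳ) (smulEnd M (X : σ → MvPolynomial σ k)) l 1 d)
    {z} (hz : z ∈ freePiece (weightedHomogeneousSubmodule k e) (F.deg 1) d)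
    (hzc : z ∈ F.cycles 1) : z ∈ F.boundaries 1 := by
  have hz' := F.d_mem_grading 0 d z (mem_freePiece_iff.1 hz)
  have hsup := mem_iSup_of_mem_positiveIdeal_smul he (F.isModuleGrading_grading 0)
    (F.gradedProj 0) hl hz' hzc
  obtain ⟨v, hv, hvz⟩ := (exists_bd_eq_incl_iff (e := fun j => (e j : ℤ)) _ l).2 hsup
  have hex := (F.shortExact_syzygy π).exists_bd_left (p := 0)
    ((F.isModuleGrading_grading 0).smulEnd_mem (X_mem_weightedGrading e)) (smulEnd_comm X)
    (by simpa using h) (incl l (F.toSyzygy z)) ⟨v, by simpa using hv, by rw [map_incl]; exact hvz⟩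
  rw [zero_add, exists_bd_eq_incl_iff] at hex
  obtain ⟨w, hw, hwz⟩ := F.tail.iSup_le_map_ε he _ l d hex
  change F.J 1 →₀ MvPolynomial σ k at w
  have hker : F.d 0 (z - w) = 0 := by
    rw [← toSyzygy_eq_zero_iff, map_sub, sub_eq_zero]
    exact hwz.symm
  rw [← add_sub_cancel w z]
  exact Submodule.add_mem_sup hw ((F.exact_succ 0 _).1 hker)

end

variable {σ : Type} [Fintype σ] {k : Type u} [Field k] {e : σ → ℕ}

/-- Both sides shift: Tor by passing to `tail`, and Koszul homology because F₀ has none in positive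
homological degrees. The shift stops at homological degree one, since F₀ does have homology in
degree zero. -/
theorem mem_boundaries_succ (he : ∀ j, 0 < e j) {l : List σ} (hl : ∀ j, j ∈ l) (hl' : l.Nodup)
    {d : ℕ} (i : ℕ) {M : Type u} [AddCommGroup M] [Module k M] [Module (MvPolynomial σ k) M]
    {ℳ : ℕ → Submodule k M} (F : GradedFreeResolution (weightedHomogeneousSubmodule k e) ℳ)
    (π : GradedProj (intGrading ℳ))
    (h : Acyclic (fun j => (e j : ℤ)) (intGrading ℳ) (smulEnd M (X : σ → MvPolynomial σ k)) l
      (i + 1 : ℕ) d)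
    {z} (hz : z ∈ freePiece (weightedHomogeneousSubmodule k e) (F.deg (i + 1)) d)
    (hzc : z ∈ F.cycles (i + 1)) : z ∈ F.boundaries (i + 1) := by
  induction i generalizing M with
  | zero => exact F.mem_boundaries_one he π hl (by simpa using h) hz hzc
  | succ i ih =>
    refine ih F.tail (F.syzygyProj π) ?_ hz hzc
    exact (F.shortExact_syzygy π).acyclic_left
      ((F.isModuleGrading_grading 0).smulEnd_mem (X_mem_weightedGrading e)) (smulEnd_comm X)
      (F.acyclic_grading hl' 0 (by positivity) _) (by exact_mod_cast h)

variable {M : Type u} [AddCommGroup M] [Module k M] [Module (MvPolynomial σ k) M]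
  {ℳ : ℕ → Submodule k M}

/-- `Tor` vanishes where Koszul homology does. -/
theorem mem_boundaries_of_acyclic (he : ∀ j, 0 < e j) {l : List σ} (hl : ∀ j, j ∈ l)
    (hl' : l.Nodup) {d i : ℕ} (F : GradedFreeResolution (weightedHomogeneousSubmodule k e) ℳ)
    (π : GradedProj (intGrading ℳ))
    (h : Acyclic (fun j => (e j : ℤ)) (intGrading ℳ) (smulEnd M (X : σ → MvPolynomial σ k)) l i d)
    {z} (hz : z ∈ freePiece (weightedHomogeneousSubmodule k e) (F.deg i) d)
    (hzc : z ∈ F.cycles i) : z ∈ F.boundaries i := by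
  cases i with
  | zero => exact F.mem_boundaries_zero he (by simpa using h) hz
  | succ i => exact F.mem_boundaries_succ he hl hl' i π h hz hzc

/-- Koszul homology in homological degree one vanishes where `Tor` does. -/
theorem acyclic_one (he : ∀ j, 0 < e j) {l : List σ} (hl : ∀ j, j ∈ l) (hl' : l.Nodup)
    {d : ℕ} (F : GradedFreeResolution (weightedHomogeneousSubmodule k e) ℳ)
    (π : GradedProj (intGrading ℳ))
    (h : ∀ z ∈ F.cycles 1, z ∈ freePiece (weightedHomogeneousSubmodule k e) (F.deg 1) d →
      z ∈ F.boundaries 1) :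
    Acyclic (fun j => (e j : ℤ)) (intGrading ℳ) (smulEnd M (X : σ → MvPolynomial σ k)) l 1 d := by
  -- As F₀ has no H₁, only the image of the connecting map matters: a syzygy that lies in A₊F₀ has
  -- to lie in A₊ times the syzygy module.
  refine (F.shortExact_syzygy π).acyclic_right
    ((F.isModuleGrading_grading 0).smulEnd_mem (X_mem_weightedGrading e))
    (F.acyclic_grading hl' 0 one_pos _) ?_
  rintro u hu ⟨v, hv, hvu⟩
  rw [sub_self] at hu
  obtain ⟨y, hy, rfl⟩ := exists_incl_of_mem_piece_zero l hu
  rw [map_incl] at hvu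
  have hsup := (exists_bd_eq_incl_iff _ l).1 ⟨v, hv, hvu⟩
  have hyI : (y : F.J 0 →₀ MvPolynomial σ k) ∈
      positiveIdeal (weightedHomogeneousSubmodule k e) •
        (⊤ : Submodule (MvPolynomial σ k) (F.J 0 →₀ MvPolynomial σ k)) := by
    have hle : (⨆ i ∈ l, (F.grading 0 ((d : ℤ) - e i)).map
        (smulEnd _ (X : σ → MvPolynomial σ k) i)) ≤
        (positiveIdeal (weightedHomogeneousSubmodule k e) •
        (⊤ : Submodule (MvPolynomial σ k) (F.J 0 →₀ MvPolynomial σ k))).toAddSubgroup := by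
      refine iSup₂_le fun i _ => ?_
      rintro _ ⟨y, -, rfl⟩
      exact X_smul_mem_positiveIdeal_smul he i y
    exact hle hsup
  -- A homogeneous lift to F₁ is a cycle of F ⊗ A/A₊, so `h` makes it a boundary. Its part in the
  -- image of F₂ dies in the syzygy module, and what remains is in A₊F₁.
  obtain ⟨x, hx, rfl⟩ := (F.gradedProj 1).exists_lift (F.syzygyProj π)
    (φ := F.toSyzygy.toAddMonoidHom) F.tail.ε_mem_grading hy (F.toSyzygy_surjective y)
  obtain ⟨x₁, hx₁, x₂, hx₂, hxx⟩ := Submodule.mem_sup.1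
    (h x hyI (mem_freePiece_iff.2 hx))
  rw [exists_bd_eq_incl_iff]
  refine mem_iSup_of_mem_positiveIdeal_smul he F.isModuleGrading_syzygy (F.syzygyProj π) hl hy ?_
  have h2 : F.toSyzygy x₂ = 0 := (F.toSyzygy_eq_zero_iff _).2 ((F.exact_succ 0 _).2 hx₂)
  change F.toSyzygy x ∈ _
  rw [← hxx, map_add, h2, add_zero]
  have := Submodule.mem_map_of_mem (f := F.toSyzygy) hx₁
  rw [Submodule.map_smul''] at this
  exact Submodule.smul_mono le_rfl le_top this

end GradedFreeResolution

/-! ### Existence of graded free resolutions. -/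

/-- A graded module over a weighted polynomial ring, with its projections. -/
structure GradedModuleData {σ : Type} (k : Type u) [Field k] (e : σ → ℕ) where
  N : Type u
  [addCommGroup : AddCommGroup N]
  [module : Module (MvPolynomial σ k) N]
  P : ℤ → AddSubgroup N
  isModuleGrading : IsModuleGrading (weightedGrading k e) P
  π : GradedProj P

namespace GradedModuleData

attribute [instance] addCommGroup module

variable {σ : Type} {k : Type u} [Field k] {e : σ → ℕ} (D : GradedModuleData k e)

/-- All homogeneous elements, with their degrees. -/
def J : Type u := {y : ℕ × D.N // y.2 ∈ D.P y.1}

/-- The degree of a homogeneous element. -/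
def deg (j : D.J) : ℕ := j.1.1

/-- The map from the free module on all homogeneous elements. -/
def cover : (D.J →₀ MvPolynomial σ k) →ₗ[MvPolynomial σ k] D.N :=
  Finsupp.linearCombination _ fun j => j.1.2

theorem cover_mem (n : ℤ) (g)
    (hg : g ∈ freeGrading (weightedGrading k e) (fun j => (D.deg j : ℤ)) n) : D.cover g ∈ D.P n :=
  D.isModuleGrading.linearCombination_mem (fun j => j.2) hg

theorem cover_surjective : Function.Surjective D.cover := by
  intro x
  obtain ⟨s, hs⟩ := D.π.exists_sum x
  rw [← LinearMap.mem_range, hs s subset_rfl]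
  refine sum_mem fun n _ => ?_
  rcases lt_or_ge n 0 with hn | hn
  · rw [D.isModuleGrading.eq_zero hn (D.π.mem n x)]
    exact zero_mem _
  · obtain ⟨n, rfl⟩ := Int.eq_ofNat_of_zero_le hn
    let j : D.J := ⟨(n, D.π.proj n x), D.π.mem n x⟩
    refine ⟨Finsupp.single j 1, ?_⟩
    rw [cover, Finsupp.linearCombination_single, one_smul]

/-- The kernel of the map from the free module on all homogeneous elements. -/
def next : GradedModuleData k e where
  N := LinearMap.ker D.cover
  P := subGrading (freeGrading (weightedGrading k e) fun j => (D.deg j : ℤ)) _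
  isModuleGrading := (IsModuleGrading.free (isRingGrading_weightedGrading e)
    fun _ => Int.natCast_nonneg _).sub _
  π := ((weightedProj k e).free _).ofInjective (LinearMap.ker D.cover).subtype.toAddMonoidHom
    Subtype.val_injective (fun _ _ => Iff.rfl) fun n x =>
      ⟨⟨((weightedProj k e).free _).proj n x, by
        have := ((weightedProj k e).free fun j => (D.deg j : ℤ)).map_proj D.π
          (φ := D.cover.toAddMonoidHom) D.cover_mem n x
        refine LinearMap.mem_ker.2 (this.trans ?_)
        rw [show D.cover.toAddMonoidHom x = 0 from x.2, map_zero]⟩, rfl⟩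

/-- The iterated kernels. -/
def iter : ℕ → GradedModuleData k e
  | 0 => D
  | n + 1 => (iter n).next

/-- The differentials of the resolution by free modules on all homogeneous elements. -/
def diff (D : GradedModuleData k e) :
    (D.next.J →₀ MvPolynomial σ k) →ₗ[MvPolynomial σ k] (D.J →₀ MvPolynomial σ k) :=
  (LinearMap.ker D.cover).subtype ∘ₗ D.next.cover

theorem exact_diff_cover : Function.Exact D.diff D.cover := by
  intro x
  constructor
  · intro hx
    obtain ⟨y, hy⟩ := D.next.cover_surjective ⟨x, hx⟩
    exact ⟨y, congrArg Subtype.val hy⟩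
  · rintro ⟨y, rfl⟩
    exact (D.next.cover y).2

theorem exact_diff_diff : Function.Exact D.next.diff D.diff := by
  intro x
  rw [← D.next.exact_diff_cover x]
  exact (LinearMap.ker D.cover).coe_eq_zero

theorem diff_mem (n : ℕ) (x)
    (hx : x ∈ freePiece (weightedHomogeneousSubmodule k e) D.next.deg n) :
    D.diff x ∈ freePiece (weightedHomogeneousSubmodule k e) D.deg n :=
  mem_freePiece_iff.2 (D.next.cover_mem n x (mem_freePiece_iff.1 hx))

end GradedModuleData

/-- Graded modules over a weighted polynomial ring have graded free resolutions. -/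
theorem nonempty_gradedFreeResolution {σ : Type} {k : Type u} [Field k] {e : σ → ℕ} {M : Type u}
    [AddCommGroup M] [Module k M] [Module (MvPolynomial σ k) M] {ℳ : ℕ → Submodule k M}
    (hM : IsModuleGrading (weightedGrading k e) (intGrading ℳ)) (π : GradedProj (intGrading ℳ)) :
    Nonempty (GradedFreeResolution (weightedHomogeneousSubmodule k e) ℳ) :=
  let D : GradedModuleData k e := ⟨M, intGrading ℳ, hM, π⟩
  ⟨{ J := fun i => (D.iter i).J
     deg := fun i => (D.iter i).deg
     d := fun i => (D.iter i).diff
     ε := D.cover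
     d_graded := fun i => (D.iter i).diff_mem
     ε_graded := fun n x hx =>
      mem_intGrading_natCast.1 (D.cover_mem n x (mem_freePiece_iff.1 hx))
     ε_surjective := D.cover_surjective
     exact_zero := D.exact_diff_cover
     exact_succ := fun i => (D.iter i).exact_diff_diff }⟩

/-! ### Degree bounds for finite groups acting on domains -/

section Noether

variable {B : Type u} [CommRing B] [IsDomain B] {H : Type v} [Group H] [Fintype H]
  [MulSemiringAction H B] [FaithfulSMul H B]

/-- A projection onto the invariants that is linear over them is a combination of the elements of
the group, over the field of fractions. -/
theorem sum_mul_eq_zero_of_forall_smul {π : B →+ B} (hπ : ∀ (h : H) x, h • π x = π x)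
    (hlin : ∀ r, (∀ h : H, h • r = r) → ∀ x, π (r * x) = r * π x) {ι : Type w} (s : Finset ι)
    (b c : ι → B) (hbc : ∀ g : H, ∑ i ∈ s, b i * g • c i = 0) :
    ∑ i ∈ s, b i * π (c i) = 0 := by
  set y := ∑ i ∈ s, b i * π (c i) with hy
  -- The trace of xy vanishes for every `x`: the traces of x b_i are invariant and move inside `π`,
  -- and the argument of `π` becomes a combination of translates of the sums in `hbc`.
  have htr : ∀ x : B, ∑ h : H, (h • y) * (h • x) = 0 := by
    intro x
    have hfix : ∀ i, ∀ g : H, g • ∑ h : H, h • (x * b i) = ∑ h : H, h • (x * b i) := by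
      intro i g
      rw [Finset.smul_sum]
      simp only [smul_smul]
      exact Fintype.sum_equiv (Equiv.mulLeft g) _ _ fun h => rfl
    calc ∑ h : H, (h • y) * (h • x)
        = ∑ h : H, ∑ i ∈ s, (h • (x * b i)) * π (c i) := by
          refine Finset.sum_congr rfl fun h _ => ?_
          rw [hy, Finset.smul_sum, Finset.sum_mul]
          refine Finset.sum_congr rfl fun i _ => ?_
          rw [smul_mul', smul_mul', hπ]
          ring
      _ = ∑ i ∈ s, (∑ h : H, h • (x * b i)) * π (c i) := by
          rw [Finset.sum_comm]
          simp only [Finset.sum_mul]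
      _ = π (∑ i ∈ s, (∑ h : H, h • (x * b i)) * c i) := by
          rw [map_sum]
          exact Finset.sum_congr rfl fun i _ => (hlin _ (hfix i) _).symm
      _ = π (∑ h : H, (h • x) * h • ∑ i ∈ s, b i * h⁻¹ • c i) := by
          congr 1
          simp only [Finset.sum_mul, Finset.smul_sum, Finset.mul_sum]
          rw [Finset.sum_comm]
          refine Finset.sum_congr rfl fun h _ => Finset.sum_congr rfl fun i _ => ?_
          rw [smul_mul', smul_mul', smul_inv_smul, mul_assoc]
      _ = 0 := by simp only [hbc, smul_zero, mul_zero, Finset.sum_const_zero, map_zero]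
  have hinj : Function.Injective
      fun h : H => (MulSemiringAction.toRingHom H B h : B →* B) := by
    intro g h hgh
    exact FaithfulSMul.eq_of_smul_eq_smul fun x : B => DFunLike.congr_fun hgh x
  -- Dedekind independence of the distinct characters x ↦ h • x of the domain `B`: all coefficients
  -- h • y vanish, in particular the one at h = 1.
  have hli := (linearIndependent_monoidHom B B).comp _ hinj
  have h1 := Fintype.linearIndependent_iff.1 hli (fun h => h • y) (by
    funext x
    simpa [Finset.sum_apply] using htr x) 1
  simpa using h1

/-- Benson's form of the Noether bound. -/
theorem prod_mem_of_forall_mem {π : B →+ B} (hπ : ∀ (h : H) x, h • π x = π x)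
    (hlin : ∀ r, (∀ h : H, h • r = r) → ∀ x, π (r * x) = r * π x) (hone : π 1 = 1) {I : Ideal B}
    (f : H → B) (hf : ∀ t : Finset H, t.Nonempty → π (∏ h ∈ t, h • f h) ∈ I) :
    ∏ h, f h ∈ I := by
  classical
  have h := sum_mul_eq_zero_of_forall_smul (H := H) hπ hlin (Finset.univ : Finset H).powerset
    (fun t => (-1) ^ t.card * ∏ h ∈ Finset.univ \ t, f h) (fun t => ∏ h ∈ t, h • f h) (by
      intro g
      -- The factor at g⁻¹ is zero. Expanding over subsets gives one relation for each `g`, and the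
      -- preceding lemma replaces `g` in all of them by `π`. The empty subset then contributes the
      -- product of the `f h`, and the others contribute elements of `I`.
      have h0 : ∏ h : H, (-(g • h • f h) + f h) = 0 :=
        Finset.prod_eq_zero (Finset.mem_univ g⁻¹) (by rw [smul_inv_smul, neg_add_cancel])
      rw [Finset.prod_add] at h0
      rw [← h0]
      refine Finset.sum_congr rfl fun t _ => ?_
      rw [Finset.smul_prod', Finset.prod_neg]
      ring)
  rw [← Finset.add_sum_erase _ _ (Finset.empty_mem_powerset _)] at h
  simp only [Finset.card_empty, pow_zero, Finset.sdiff_empty, one_mul, Finset.prod_empty, hone,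
    mul_one] at h
  rw [eq_neg_of_add_eq_zero_left h]
  refine neg_mem (sum_mem fun t ht => Ideal.mul_mem_left _ _ (hf t ?_))
  exact Finset.nonempty_iff_ne_empty.2 (Finset.ne_of_mem_erase ht)

end Noether

/-! ### The group action on k[V], graded splittings and the Noether bound. -/

section Invariants

variable {k : Type u} [Field k]

/-- The factors are indexed by a finite set rather than by numbers so that the set can be the group
itself, as Benson's argument requires. -/
theorem homogeneousSubmodule_le_span_prod {σ H : Type*} [DecidableEq H] (T : Finset H) :
    homogeneousSubmodule σ k T.card ≤ Submodule.span k
      {p | ∃ f : H → MvPolynomial σ k, (∀ h, (f h).IsHomogeneous 1) ∧ ∏ h ∈ T, f h = p} := by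
  induction T using Finset.induction_on with
  | empty =>
    rw [Finset.card_empty, ← homogeneousSubmodule_one_pow, pow_zero, Submodule.one_eq_span]
    refine Submodule.span_mono ?_
    rintro _ rfl
    exact ⟨fun _ => 0, fun _ => isHomogeneous_zero _ _ _, Finset.prod_empty⟩
  | insert a T ha ih =>
    rw [Finset.card_insert_of_notMem ha, ← homogeneousSubmodule_one_pow, pow_succ',
      homogeneousSubmodule_one_pow, Submodule.mul_le]
    intro x hx y hy
    replace hy := ih hy
    induction hy using Submodule.span_induction with
    | mem y hy =>
      obtain ⟨f, hf, rfl⟩ := hy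
      refine Submodule.subset_span ⟨Function.update f a x, fun h => ?_, ?_⟩
      · by_cases hh : h = a
        · subst hh
          rwa [Function.update_self]
        · rw [Function.update_of_ne hh]
          exact hf h
      · rw [Finset.prod_insert ha, Function.update_self, Finset.prod_update_of_notMem ha]
    | zero =>
      rw [mul_zero]
      exact zero_mem _
    | add y z _ _ hy hz =>
      rw [mul_add]
      exact add_mem hy hz
    | smul c y _ hy =>
      rw [mul_smul_comm]
      exact Submodule.smul_mem _ c hy

variable {G : Type v} [Group G] {V : Type w} [AddCommGroup V] [Module k V] {n : ℕ}
  (b : Module.Basis (Fin n) k V) (ρ : Representation k G V)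

theorem polyAction_X (g : G) (i : Fin n) :
    polyAction b ρ g (X i) = ∑ j, C (b.repr (ρ g (b i)) j) * X j := aeval_X _ _

theorem polyAction_one : polyAction b ρ 1 = AlgHom.id k _ := by
  classical
  ext i : 1
  rw [polyAction_X, map_one, Module.End.one_apply, Module.Basis.repr_self,
    Finset.sum_eq_single i]
  · simp
  · intro j _ hj
    simp [hj.symm]
  · simp

theorem polyAction_mul (g h : G) :
    polyAction b ρ (g * h) = (polyAction b ρ g).comp (polyAction b ρ h) := by
  ext i : 1
  rw [AlgHom.comp_apply, polyAction_X, polyAction_X, map_mul, Module.End.mul_apply]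
  simp only [map_sum, map_mul, polyAction_X, algHom_C]
  conv_lhs => rw [← b.sum_repr (ρ h (b i))]
  simp only [map_sum, map_smul, Finsupp.coe_finsetSum, Finset.sum_apply, Finsupp.smul_apply,
    smul_eq_mul, Finset.sum_mul, Finset.mul_sum, map_mul]
  rw [Finset.sum_comm]
  refine Finset.sum_congr rfl fun j _ => Finset.sum_congr rfl fun l _ => ?_
  simp only [algebraMap_eq, mul_assoc]

theorem isHomogeneous_polyAction (g : G) {m : ℕ} {p : MvPolynomial (Fin n) k}
    (hp : p.IsHomogeneous m) : (polyAction b ρ g p).IsHomogeneous m := by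
  have := hp.aeval (fun i => ∑ j, C (b.repr (ρ g (b i)) j) * X j) (n := 1) fun i =>
    IsHomogeneous.sum _ _ _ fun j _ => isHomogeneous_C_mul_X _ _
  rwa [one_mul] at this

/-- The action of the group on the polynomial ring. -/
def polyActionHom : G →* (MvPolynomial (Fin n) k ≃ₐ[k] MvPolynomial (Fin n) k) where
  toFun g := AlgEquiv.ofAlgHom (polyAction b ρ g) (polyAction b ρ g⁻¹)
    (by rw [← polyAction_mul, mul_inv_cancel, polyAction_one])
    (by rw [← polyAction_mul, inv_mul_cancel, polyAction_one])
  map_one' := AlgEquiv.ext fun x => DFunLike.congr_fun (polyAction_one b ρ) x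
  map_mul' g h := AlgEquiv.ext fun x => DFunLike.congr_fun (polyAction_mul b ρ g h) x

theorem mem_invariantRing {p : MvPolynomial (Fin n) k} :
    p ∈ invariantRing b ρ ↔ ∀ g, polyAction b ρ g p = p := by
  rw [invariantRing, Algebra.mem_iInf]
  rfl

theorem homogeneousComponent_mem_invariantRing {p : MvPolynomial (Fin n) k}
    (hp : p ∈ invariantRing b ρ) (m : ℕ) : homogeneousComponent m p ∈ invariantRing b ρ := by
  rw [mem_invariantRing] at hp ⊢
  intro g
  have h : ∀ q, polyAction b ρ g (homogeneousComponent m q) =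
      homogeneousComponent m (polyAction b ρ g q) := by
    intro q
    have h := (weightedProj k (1 : Fin n → ℕ)).map_proj (weightedProj k (1 : Fin n → ℕ))
      (φ := (polyAction b ρ g).toLinearMap.toAddMonoidHom) (fun i x hx => by
        rcases mem_intGrading_iff.1 hx with rfl | ⟨i, rfl, hx⟩
        · rw [map_zero]
          exact zero_mem _
        · exact mem_intGrading_natCast.2 (isHomogeneous_polyAction b ρ g hx)) m q
    exact h
  rw [h, hp g]

/-- The Reynolds operator. -/
theorem isSplitInvariants_of_card_ne_zero [Finite G] (h : (Nat.card G : k) ≠ 0) :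
    IsSplitInvariants b ρ := by
  have := Fintype.ofFinite G
  have hmem : ∀ x : MvPolynomial (Fin n) k,
      (Nat.card G : k)⁻¹ • ∑ g : G, polyAction b ρ g x ∈ invariantRing b ρ := by
    intro x
    rw [mem_invariantRing]
    intro g
    have hsum : ∑ g' : G, polyAction b ρ g (polyAction b ρ g' x) = ∑ g' : G, polyAction b ρ g' x :=
      Fintype.sum_equiv (Equiv.mulLeft g) _ _ fun g' => by
        rw [Equiv.coe_mulLeft, polyAction_mul, AlgHom.comp_apply]
    rw [map_smul, map_sum, hsum]
  refine ⟨{ toFun := fun x => ⟨_, hmem x⟩, map_add' := ?_, map_smul' := ?_ }, ?_⟩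
  · intro x y
    apply Subtype.ext
    simp only [map_add, Finset.sum_add_distrib, smul_add, Subalgebra.coe_add]
  · intro r x
    apply Subtype.ext
    have hr := (mem_invariantRing b ρ).1 r.2
    simp only [Subalgebra.smul_def, smul_eq_mul, map_mul, hr, ← Finset.mul_sum, RingHom.id_apply,
      Subalgebra.coe_mul, mul_smul_comm]
  · intro x
    apply Subtype.ext
    have hx := (mem_invariantRing b ρ).1 x.2
    simp only [LinearMap.coe_mk, AddHom.coe_mk, hx, Finset.sum_const, Finset.card_univ,
      ← Nat.card_eq_fintype_card]
    rw [← Nat.cast_smul_eq_nsmul k, smul_smul, inv_mul_cancel₀ h, one_smul]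

theorem homogeneousComponent_mul_of_isHomogeneous {σ : Type} {i : ℕ} {r : MvPolynomial σ k}
    (hr : r.IsHomogeneous i) (j : ℕ) (y : MvPolynomial σ k) :
    homogeneousComponent (i + j) (r * y) = r * homogeneousComponent j y := by
  have h := (weightedProj k (1 : σ → ℕ)).map_proj_shift (weightedProj k (1 : σ → ℕ))
    (φ := AddMonoidHom.mulLeft r) (c := i) (fun m x hx => by
      rw [add_comm]
      exact mul_mem_weightedGrading _ (mem_intGrading_natCast.2 hr) hx) j y
  rw [add_comm i j]
  exact h.symm

/-- A splitting of the inclusion of the invariants can be taken to preserve degrees. -/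
theorem IsSplitInvariants.exists_graded (h : IsSplitInvariants b ρ) :
    ∃ φ : MvPolynomial (Fin n) k →ₗ[k] MvPolynomial (Fin n) k,
      (∀ x, φ x ∈ invariantRing b ρ) ∧ (∀ r ∈ invariantRing b ρ, ∀ x, φ (r * x) = r * φ x) ∧
      φ 1 = 1 ∧ ∀ m p, p.IsHomogeneous m → (φ p).IsHomogeneous m := by
  obtain ⟨π, hπ⟩ := h
  let ψ : MvPolynomial (Fin n) k →ₗ[k] MvPolynomial (Fin n) k :=
    (invariantRing b ρ).val.toLinearMap ∘ₗ π.restrictScalars k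
  have hψ : ∀ x, ψ x ∈ invariantRing b ρ := fun x => (π x).2
  have hψr : ∀ r ∈ invariantRing b ρ, ∀ x, ψ (r * x) = r * ψ x := fun r hr x =>
    congrArg Subtype.val (π.map_smul ⟨r, hr⟩ x)
  have hψ1 : ψ 1 = 1 := congrArg Subtype.val (hπ 1)
  -- The degree-preserving part of `ψ`, defined on monomials. It remains linear over the invariants
  -- because homogeneous components of invariants are invariant.
  let φ : MvPolynomial (Fin n) k →ₗ[k] MvPolynomial (Fin n) k :=
    (basisMonomials (Fin n) k).constr k fun s =>
      homogeneousComponent s.degree (ψ (monomial s 1))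
  have hφs : ∀ s c, φ (monomial s c) = homogeneousComponent s.degree (ψ (monomial s c)) := by
    intro s c
    have h1 : (monomial s c : MvPolynomial (Fin n) k) = c • basisMonomials (Fin n) k s := by
      rw [coe_basisMonomials, smul_monomial, smul_eq_mul, mul_one]
    rw [h1, map_smul, Module.Basis.constr_basis, map_smul, map_smul, coe_basisMonomials]
  have hφ : ∀ m p, p.IsHomogeneous m → φ p = homogeneousComponent m (ψ p) := by
    intro m p hp
    conv_lhs => rw [p.as_sum]
    conv_rhs => rw [p.as_sum]
    simp only [map_sum]
    refine Finset.sum_congr rfl fun s hs => ?_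
    rw [hφs, hp.degree_eq_sum_deg_support hs]
    rfl
  refine ⟨φ, fun x => ?_, fun r hr x => ?_, ?_, fun m p hp => ?_⟩
  · rw [x.as_sum, map_sum]
    refine sum_mem fun s _ => ?_
    rw [hφs]
    exact homogeneousComponent_mem_invariantRing b ρ (hψ _) _
  · rw [← sum_homogeneousComponent r, Finset.sum_mul, map_sum, Finset.sum_mul]
    refine Finset.sum_congr rfl fun i _ => ?_
    rw [← sum_homogeneousComponent x, Finset.mul_sum, map_sum, map_sum, Finset.mul_sum]
    refine Finset.sum_congr rfl fun j _ => ?_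
    have hi := homogeneousComponent_isHomogeneous i r
    have hj := homogeneousComponent_isHomogeneous j x
    rw [hφ _ _ (hi.mul hj), hφ _ _ hj,
      hψr _ (homogeneousComponent_mem_invariantRing b ρ hr i),
      homogeneousComponent_mul_of_isHomogeneous hi]
  · rw [hφ 0 1 (isHomogeneous_one _ _), hψ1,
      homogeneousComponent_of_mem (isHomogeneous_one _ _), if_pos rfl]
  · rw [hφ m p hp]
    exact homogeneousComponent_isHomogeneous _ _

/-- Forms of degree `m` are sums of products of forms of degrees m - τ and τ. -/
theorem mem_hilbertIdeal_of_isHomogeneous_mul {m τ : ℕ}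
    (hτ : ∀ p : MvPolynomial (Fin n) k, p.IsHomogeneous τ → p ∈ hilbertIdeal b ρ) (hm : τ ≤ m)
    {p : MvPolynomial (Fin n) k} (hp : p.IsHomogeneous m) : p ∈ hilbertIdeal b ρ := by
  have hp' : p ∈ homogeneousSubmodule (Fin n) k (m - τ) * homogeneousSubmodule (Fin n) k τ := by
    rw [← homogeneousSubmodule_one_pow _ (m - τ), ← homogeneousSubmodule_one_pow _ τ, ← pow_add,
      Nat.sub_add_cancel hm, homogeneousSubmodule_one_pow]
    exact hp
  refine Submodule.mul_induction_on hp' (fun x _ y hy => ?_) fun x y hx hy => add_mem hx hy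
  exact Ideal.mul_mem_left _ _ (hτ y hy)

/-- The Noether bound: everything of degree at least the order of the group is in the Hilbert
ideal. -/
theorem mem_hilbertIdeal_of_isHomogeneous_card [Finite G] (h : IsSplitInvariants b ρ)
    {p : MvPolynomial (Fin n) k} (hp : p.IsHomogeneous (Nat.card G)) :
    p ∈ hilbertIdeal b ρ := by
  classical
  obtain ⟨φ, hφ, hφr, hφ1, hφh⟩ := h.exists_graded
  -- Independence of characters needs a faithful action, so `G` is replaced by its image, whose
  -- order is at most that of `G`.
  let H := (polyActionHom b ρ).range
  have : Finite H := Set.finite_range (polyActionHom b ρ)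
  have := Fintype.ofFinite H
  have hfix : ∀ x, x ∈ invariantRing b ρ ↔ ∀ g : H, g • x = x := by
    intro x
    rw [mem_invariantRing]
    constructor
    · rintro hx ⟨_, g, rfl⟩
      exact hx g
    · exact fun hx g => hx ⟨_, g, rfl⟩
  have hhom : ∀ (g : H) m (x : MvPolynomial (Fin n) k), x.IsHomogeneous m →
      (g • x).IsHomogeneous m := by
    rintro ⟨_, g, rfl⟩ m x hx
    exact isHomogeneous_polyAction b ρ g hx
  have hprod : ∀ f : H → MvPolynomial (Fin n) k, (∀ g, (f g).IsHomogeneous 1) →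
      ∏ g, f g ∈ hilbertIdeal b ρ := by
    intro f hf
    refine prod_mem_of_forall_mem (π := φ.toAddMonoidHom)
      (fun g x => (hfix _).1 (hφ x) g) (fun r hr x => hφr r ((hfix r).2 hr) x) hφ1 f
      fun t ht => ?_
    refine Ideal.subset_span ⟨hφ _, t.card, Finset.card_pos.2 ht, hφh _ _ ?_⟩
    have := IsHomogeneous.prod t (fun g => g • f g) (fun _ => 1) fun g _ => hhom g 1 _ (hf g)
    simpa using this
  have hcard : (Finset.univ : Finset H).card ≤ Nat.card G := by
    rw [Finset.card_univ, ← Nat.card_eq_fintype_card]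
    exact Nat.card_le_card_of_surjective _ (polyActionHom b ρ).rangeRestrict_surjective
  refine mem_hilbertIdeal_of_isHomogeneous_mul b ρ (fun q hq => ?_) hcard hp
  have hle : Submodule.span k {p | ∃ f : H → MvPolynomial (Fin n) k,
      (∀ h, (f h).IsHomogeneous 1) ∧ ∏ h, f h = p} ≤
      (hilbertIdeal b ρ).restrictScalars k := by
    refine Submodule.span_le.2 ?_
    rintro _ ⟨f, hf, rfl⟩
    exact hprod f hf
  exact hle (homogeneousSubmodule_le_span_prod Finset.univ hq)

/-- The Noether bound shows that the set in the definition of `tau` is nonempty; otherwise its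
infimum would be the default value 0. -/
theorem tau_mem [Finite G] (h : IsSplitInvariants b ρ) :
    0 < tau b ρ ∧
      ∀ p : MvPolynomial (Fin n) k, p.IsHomogeneous (tau b ρ) → p ∈ hilbertIdeal b ρ :=
  Nat.sInf_mem (s := {m | 0 < m ∧ ∀ p : MvPolynomial (Fin n) k, p.IsHomogeneous m →
      p ∈ hilbertIdeal b ρ})
    ⟨Nat.card G, Nat.card_pos, fun _ hp => mem_hilbertIdeal_of_isHomogeneous_card b ρ h hp⟩

theorem tau_le_card [Finite G] (h : IsSplitInvariants b ρ) : tau b ρ ≤ Nat.card G :=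
  Nat.sInf_le ⟨Nat.card_pos, fun _ hp => mem_hilbertIdeal_of_isHomogeneous_card b ρ h hp⟩

end Invariants

/-! ### Minimal generators of the ring of invariants and their degrees. -/

section Generators

variable {k : Type u} [Field k] {G : Type v} [Group G] {V : Type w} [AddCommGroup V] [Module k V]
  {n : ℕ} {b : Module.Basis (Fin n) k V} {ρ : Representation k G V} {r : ℕ}
  {f : Fin r → invariantRing b ρ} {e : Fin r → ℕ}

theorem mem_weightedGrading_one_iff {σ : Type} {m : ℕ} {p : MvPolynomial σ k} :
    p ∈ weightedGrading k (1 : σ → ℕ) m ↔ p.IsHomogeneous m := mem_intGrading_natCast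

namespace IsMinimalGenerators

theorem isHomogeneous (hf : IsMinimalGenerators b ρ f e) (j : Fin r) :
    (f j : MvPolynomial (Fin n) k).IsHomogeneous (e j) := hf.homogeneous j

theorem notMem_adjoin (hf : IsMinimalGenerators b ρ f e) (j : Fin r) :
    f j ∉ Algebra.adjoin k (f '' {j}ᶜ) := by
  intro h
  refine hf.minimal j (top_le_iff.1 ?_)
  rw [← hf.generates]
  refine Algebra.adjoin_le ?_
  rintro _ ⟨i, rfl⟩
  by_cases hij : i = j
  · rwa [hij]
  · exact Algebra.subset_adjoin ⟨i, hij, rfl⟩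

theorem val_notMem_adjoin (hf : IsMinimalGenerators b ρ f e) (j : Fin r) :
    (f j : MvPolynomial (Fin n) k) ∉
      Algebra.adjoin k ((fun i => (f i : MvPolynomial (Fin n) k)) '' {j}ᶜ) := by
  intro h
  refine hf.notMem_adjoin j ?_
  have himg : (fun i => (f i : MvPolynomial (Fin n) k)) '' {j}ᶜ =
      (invariantRing b ρ).val '' (f '' {j}ᶜ) := by
    rw [Set.image_image]
    rfl
  rw [himg, ← AlgHom.map_adjoin] at h
  obtain ⟨x, hx, hxf⟩ := h
  rwa [← Subtype.ext hxf]

/-- An invariant of degree zero is a scalar and would be redundant as a generator. -/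
theorem degree_pos (hf : IsMinimalGenerators b ρ f e) (j : Fin r) : 0 < e j := by
  refine Nat.pos_of_ne_zero fun h => hf.val_notMem_adjoin j ?_
  have hj := hf.isHomogeneous j
  rw [h, ← mem_homogeneousSubmodule, homogeneousSubmodule_zero, Submodule.mem_one] at hj
  obtain ⟨c, hc⟩ := hj
  rw [← hc]
  exact Subalgebra.algebraMap_mem _ c

theorem aeval_mem_weightedGrading (hf : IsMinimalGenerators b ρ f e) (m : ℤ)
    (q : MvPolynomial (Fin r) k) (hq : q ∈ weightedGrading k e m) :
    aeval (fun j => (f j : MvPolynomial (Fin n) k)) q ∈ weightedGrading k (1 : Fin n → ℕ) m := by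
  rcases mem_intGrading_iff.1 hq with rfl | ⟨m, rfl, hq'⟩
  · rw [map_zero]
    exact zero_mem _
  rw [mem_weightedGrading_one_iff, q.as_sum, map_sum]
  refine IsHomogeneous.sum _ _ _ fun s hs => ?_
  rw [aeval_monomial, algebraMap_eq]
  refine IsHomogeneous.C_mul ?_ _
  have h := IsHomogeneous.prod s.support (fun j => (f j : MvPolynomial (Fin n) k) ^ s j)
    (fun j => e j * s j) fun j _ => (hf.isHomogeneous j).pow (s j)
  have hw := hq' (mem_support_iff.1 hs)
  rw [Finsupp.weight_apply, Finsupp.sum] at hw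
  simp only [smul_eq_mul, mul_comm] at hw h
  rwa [hw] at h

/-- A homogeneous invariant is a weighted homogeneous polynomial in the generators. -/
theorem exists_aeval_eq (hf : IsMinimalGenerators b ρ f e) {m : ℕ} {p : MvPolynomial (Fin n) k}
    (hp : p ∈ invariantRing b ρ) (hpm : p.IsHomogeneous m) :
    ∃ q : MvPolynomial (Fin r) k, q.IsWeightedHomogeneous e m ∧
      aeval (fun j => (f j : MvPolynomial (Fin n) k)) q = p := by
  have hq : ∃ q, (aeval (fun j => (f j : MvPolynomial (Fin n) k)) :
      MvPolynomial (Fin r) k →ₐ[k] _).toLinearMap.toAddMonoidHom q = p := by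
    have h : (⟨p, hp⟩ : invariantRing b ρ) ∈ (aeval f : MvPolynomial (Fin r) k →ₐ[k] _).range := by
      rw [← Algebra.adjoin_range_eq_range_aeval, hf.generates]
      trivial
    obtain ⟨q, hq⟩ := h
    refine ⟨q, ?_⟩
    have h2 := congrArg (invariantRing b ρ).val hq
    change (invariantRing b ρ).val (aeval f q) = p at h2
    rw [← AlgHom.comp_apply, comp_aeval] at h2
    exact h2
  obtain ⟨q, hqm, hqp⟩ := (weightedProj k e).exists_lift (weightedProj k (1 : Fin n → ℕ))
    hf.aeval_mem_weightedGrading (mem_weightedGrading_one_iff.2 hpm) hq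
  exact ⟨q, mem_intGrading_natCast.1 hqm, hqp⟩

/-- For degree reasons f_j cannot occur in an expression of an invariant of degree less than e_j. -/
theorem mem_adjoin (hf : IsMinimalGenerators b ρ f e) {m : ℕ} {p : MvPolynomial (Fin n) k}
    (hp : p ∈ invariantRing b ρ) (hpm : p.IsHomogeneous m) {j : Fin r} (hj : m < e j) :
    p ∈ Algebra.adjoin k ((fun i => (f i : MvPolynomial (Fin n) k)) '' {j}ᶜ) := by
  obtain ⟨q, hq, rfl⟩ := hf.exists_aeval_eq hp hpm
  rw [q.as_sum, map_sum]
  refine sum_mem fun s hs => ?_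
  rw [aeval_monomial]
  refine mul_mem (Subalgebra.algebraMap_mem _ _) (prod_mem fun i hi => pow_mem ?_ _)
  refine Algebra.subset_adjoin ⟨i, ?_, rfl⟩
  rintro rfl
  have hw := hq (mem_support_iff.1 hs)
  have := Finsupp.le_weight_of_ne_zero' e (Finsupp.mem_support_iff.1 hi)
  omega

theorem hilbertIdeal_eq (hf : IsMinimalGenerators b ρ f e) :
    hilbertIdeal b ρ = Ideal.span (Set.range fun j => (f j : MvPolynomial (Fin n) k)) := by
  apply le_antisymm
  · refine Ideal.span_le.2 ?_
    rintro p ⟨hp, m, hm, hpm⟩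
    obtain ⟨q, hq, rfl⟩ := hf.exists_aeval_eq hp hpm
    have hq' : q ∈ Ideal.span (Set.range (X : Fin r → MvPolynomial (Fin r) k)) := by
      rw [← positiveIdeal_eq hf.degree_pos]
      exact Ideal.subset_span ⟨m, hm, hq⟩
    have h := Ideal.mem_map_of_mem
      (aeval (fun j => (f j : MvPolynomial (Fin n) k))).toRingHom hq'
    have hcomp : ⇑(aeval (fun j => (f j : MvPolynomial (Fin n) k)) :
        MvPolynomial (Fin r) k →ₐ[k] _).toRingHom ∘ X = fun j => (f j : MvPolynomial (Fin n) k) :=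
      funext fun j => aeval_X _ j
    rwa [Ideal.map_span, ← Set.range_comp, hcomp] at h
  · refine Ideal.span_le.2 ?_
    rintro _ ⟨j, rfl⟩
    exact Ideal.subset_span ⟨(f j).2, e j, hf.degree_pos j, hf.isHomogeneous j⟩

/-- The homogeneous elements of the Hilbert ideal are combinations of the generators with
homogeneous coefficients. -/
theorem exists_linearCombination_eq (hf : IsMinimalGenerators b ρ f e) (m : ℤ)
    (p : MvPolynomial (Fin n) k) (hp : p ∈ weightedGrading k (1 : Fin n → ℕ) m)
    (hpI : p ∈ hilbertIdeal b ρ) :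
    ∃ g ∈ freeGrading (weightedGrading k (1 : Fin n → ℕ)) (fun j => (e j : ℤ)) m,
      Finsupp.linearCombination (MvPolynomial (Fin n) k)
        (fun j => (f j : MvPolynomial (Fin n) k)) g = p := by
  have hB : IsModuleGrading (weightedGrading k (1 : Fin n → ℕ))
      (weightedGrading k (1 : Fin n → ℕ)) :=
    ⟨mul_mem_weightedGrading _, fun hn _ hx => (mem_intGrading_of_neg hn).1 hx⟩
  refine ((weightedProj k (1 : Fin n → ℕ)).free _).exists_lift (weightedProj k (1 : Fin n → ℕ))
    (φ := (Finsupp.linearCombination (MvPolynomial (Fin n) k)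
        (fun j => (f j : MvPolynomial (Fin n) k))).toAddMonoidHom)
    (fun m g hg => hB.linearCombination_mem
      (fun j => mem_weightedGrading_one_iff.2 (hf.isHomogeneous j)) hg) hp ?_
  rw [hf.hilbertIdeal_eq] at hpI
  exact (Finsupp.mem_span_range_iff_exists_finsupp.1 hpI).imp fun g hg => hg

/-- If e_j > τ, then f_j is in B₊ times forms of degree τ, which are combinations of generators f_i
with e_i ≤ τ. Applying the graded splitting to this expression yields f_j = Σ f_i r_i with
invariants r_i of degree less than e_j, so f_j is in the algebra generated by the others. -/
theorem degree_le_tau [Finite G] (hf : IsMinimalGenerators b ρ f e)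
    (h : IsSplitInvariants b ρ) (j : Fin r) : e j ≤ tau b ρ := by
  by_contra! hj
  obtain ⟨φ, hφ, hφr, hφ1, hφh⟩ := h.exists_graded
  obtain ⟨-, hτ⟩ := tau_mem b ρ h
  refine hf.val_notMem_adjoin j ?_
  have hself : φ (f j) = f j := by
    have := hφr (f j) (f j).2 1
    rwa [hφ1, mul_one] at this
  rw [← hself]
  have hmem : (f j : MvPolynomial (Fin n) k) ∈ homogeneousSubmodule (Fin n) k (e j - tau b ρ) *
      homogeneousSubmodule (Fin n) k (tau b ρ) := by
    rw [← homogeneousSubmodule_one_pow _ (e j - _), ← homogeneousSubmodule_one_pow _ (tau b ρ),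
      ← pow_add, Nat.sub_add_cancel hj.le, homogeneousSubmodule_one_pow]
    exact hf.isHomogeneous j
  refine Submodule.mul_induction_on hmem (fun x hx y hy => ?_) fun x y hx hy => by
    rw [map_add]
    exact add_mem hx hy
  obtain ⟨g, hg, rfl⟩ := hf.exists_linearCombination_eq _ y
    (mem_weightedGrading_one_iff.2 hy) (hτ y hy)
  rw [Finsupp.linearCombination_apply, Finsupp.sum, Finset.mul_sum, map_sum]
  refine sum_mem fun i _ => ?_
  have hgi := hg i
  rw [smul_eq_mul, ← mul_assoc, mul_comm, hφr _ (f i).2]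
  rcases mem_intGrading_iff.1 hgi with h0 | ⟨m, hm, hgm⟩
  · rw [h0, mul_zero, map_zero, mul_zero]
    exact zero_mem _
  · have hi := hf.degree_pos i
    have hm' : m + e i = tau b ρ := by
      have : (m : ℤ) = tau b ρ - e i := hm
      omega
    refine mul_mem (Algebra.subset_adjoin ⟨i, ?_, rfl⟩)
      (hf.mem_adjoin (hφ _) (hφh _ _ (IsHomogeneous.mul hx hgm)) (by omega))
    rintro rfl
    omega

end IsMinimalGenerators

end Generators

/-! ### Ends of Tor as vanishing statements. -/

section TorEnd

variable {k : Type u} {A : Type v} {M : Type w} [Field k] [CommRing A] [Algebra k A]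
  [AddCommGroup M] [Module k M] [Module A M] {𝒜 : ℕ → Submodule k A} {ℳ : ℕ → Submodule k M}

theorem torEnd_le {i : ℕ} {c : ℝ}
    (h : ∀ (F : GradedFreeResolution 𝒜 ℳ) (d : ℕ), c < d → ∀ z ∈ F.cycles i,
      z ∈ freePiece 𝒜 (F.deg i) d → z ∈ F.boundaries i) : torEnd 𝒜 ℳ i ≤ (c : EReal) := by
  refine iSup_le fun F => iSup₂_le fun d hd => ?_
  obtain ⟨t, ⟨z, hz, hzd, hzt⟩, ht⟩ := hd
  by_contra! hlt
  refine ht (Subtype.ext ?_)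
  rw [← hzt]
  exact (Submodule.Quotient.mk_eq_zero _).2 (h F d (by exact_mod_cast hlt) z hz hzd)

theorem mem_boundaries_of_torEnd_le {i c : ℕ} (h : torEnd 𝒜 ℳ i ≤ (c : EReal))
    (F : GradedFreeResolution 𝒜 ℳ) {d : ℕ} (hd : c < d) {z} (hz : z ∈ F.cycles i)
    (hzd : z ∈ freePiece 𝒜 (F.deg i) d) : z ∈ F.boundaries i := by
  by_contra hzb
  have h1 : (d : EReal) ≤ gradedEnd (F.torPiece i) :=
    le_iSup₂_of_le d ⟨⟨_, Submodule.mem_map_of_mem hz⟩, ⟨z, hz, hzd, rfl⟩, fun h0 =>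
      hzb ((Submodule.Quotient.mk_eq_zero _).1 (congrArg Subtype.val h0))⟩ le_rfl
  have h2 : (d : EReal) ≤ (c : EReal) :=
    h1.trans ((le_iSup (fun F : GradedFreeResolution 𝒜 ℳ => gradedEnd (F.torPiece i)) F).trans h)
  exact absurd (by exact_mod_cast h2) (not_le.2 hd)

end TorEnd

namespace Koszul

/-- If all weights are `c`, then a chain of homological degree `p` and internal degree `d` has
its coefficients in degree `d - p * c`. -/
theorem eq_zero_of_mem_piece {σ : Type w} {N : Type u} [AddCommGroup N] {e : σ → ℤ}
    {P : ℤ → AddSubgroup N} {c : ℤ} (he : ∀ j, e j = c) (l : List σ) {p d : ℤ}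
    (h : ∀ x ∈ P (d - p * c), x = 0) {z : Kos N l} (hz : z ∈ piece e P l p d) : z = 0 := by
  induction l generalizing p d with
  | nil =>
    obtain ⟨x, rfl⟩ := exists_single z
    rcases eq_or_ne p 0 with rfl | hp
    · rw [h x (by simpa using single_mem_piece.1 hz), single_zero]
    · exact (mem_piece_nil_of_ne hp).1 hz
  | cons j l ih =>
    obtain ⟨α, β, rfl⟩ := exists_pair z
    rw [pair_mem_piece] at hz
    rw [ih h hz.1, ih _ hz.2, pair_zero]
    rw [he j, show d - c - (p - 1) * c = d - p * c by ring]
    exact h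

end Koszul

/-! ### Syzygies of the Hilbert ideal and the transfer to the ring of invariants. -/

section Main

variable {k : Type u} [Field k] {n : ℕ}

/-- The Koszul homology of the variables on an ideal that contains all forms of degree at
least `τ`. -/
theorem acyclic_ideal_of_forall_mem {I : Ideal (MvPolynomial (Fin n) k)} {τ : ℤ} (hτ0 : 0 ≤ τ)
    (hτ : ∀ m, τ ≤ m → ∀ p ∈ weightedGrading k (1 : Fin n → ℕ) m, p ∈ I) (s : ℕ) (d : ℤ)
    (hd : τ + s < d) :
    Acyclic (fun _ => 1) (subGrading (weightedGrading k (1 : Fin n → ℕ)) I)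
      (smulEnd I (X : Fin n → MvPolynomial (Fin n) k)) (List.finRange n) s d := by
  intro z hz h0
  have hB : Acyclic (fun _ => 1) (weightedGrading k (1 : Fin n → ℕ))
      (smulEnd _ (X : Fin n → MvPolynomial (Fin n) k)) (List.finRange n) s d := by
    rcases Nat.eq_zero_or_pos s with rfl | hs
    · exact acyclic_X_zero (1 : Fin n → ℕ) (fun j => List.mem_finRange j) (by omega)
    · exact acyclic_X_of_pos (1 : Fin n → ℕ) (List.nodup_finRange n) (by exact_mod_cast hs) d
  have hcomm : ∀ j ∈ List.finRange n, ∀ x : I, I.subtype.toAddMonoidHom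
      (smulEnd I (X : Fin n → MvPolynomial (Fin n) k) j x) =
        smulEnd _ (X : Fin n → MvPolynomial (Fin n) k) j (I.subtype.toAddMonoidHom x) :=
    fun _ _ _ => rfl
  obtain ⟨w, hw, hwz⟩ := hB (map I.subtype.toAddMonoidHom _ z)
    (map_mem_piece (fun m x hx => hx) _ hz) (by rw [bd_map _ hcomm, h0, map_zero])
  let Q : ℤ → AddSubgroup (MvPolynomial (Fin n) k) := fun m =>
    weightedGrading k (1 : Fin n → ℕ) m ⊓ I.toAddSubgroup
  -- A bounding chain over the whole ring has coefficients of degree at least d - (s + 1) ≥ τ, so it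
  -- is a chain over `I`.
  have hQ : ∀ m, d - ((s : ℤ) + 1) * 1 ≤ m → weightedGrading k (1 : Fin n → ℕ) m ≤ Q m :=
    fun m hm p hp => ⟨hp, hτ m (by omega) p hp⟩
  have hQI : ∀ m, ∀ p ∈ Q m, ∃ q ∈ subGrading (weightedGrading k (1 : Fin n → ℕ)) I m,
      I.subtype.toAddMonoidHom q = p := fun m p hp => ⟨⟨p, hp.2⟩, hp.1, rfl⟩
  obtain ⟨y, hy, rfl⟩ := exists_lift hQI _ (piece_le_piece (fun _ => le_rfl) _ hQ hw)
  refine ⟨y, hy, map_injective (φ := I.subtype.toAddMonoidHom) Subtype.val_injective _ ?_⟩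
  rw [← bd_map _ hcomm, hwz]

/-- If all linear forms are in `I` and nothing of degree zero is, then the trivial relation between
two variables is not a consequence of relations of lower degree. -/
theorem le_one_of_acyclic_one {I : Ideal (MvPolynomial (Fin n) k)}
    (hI : ∀ p ∈ weightedGrading k (1 : Fin n → ℕ) 1, p ∈ I)
    (hI0 : ∀ p ∈ weightedGrading k (1 : Fin n → ℕ) 0, p ∈ I → p = 0)
    (h : Acyclic (fun _ => 1) (subGrading (weightedGrading k (1 : Fin n → ℕ)) I)
      (smulEnd I (X : Fin n → MvPolynomial (Fin n) k)) (List.finRange n) 1 2) : n ≤ 1 := by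
  rw [← List.length_finRange (n := n)]
  revert h
  rcases List.finRange n with _ | ⟨i, _ | ⟨j, l⟩⟩
  · simp
  · simp
  intro h
  exfalso
  have hX : ∀ i : Fin n, (X i : MvPolynomial (Fin n) k) ∈ weightedGrading k (1 : Fin n → ℕ) 1 :=
    fun i => X_mem_weightedGrading (1 : Fin n → ℕ) i
  let x : Fin n → I := fun i => ⟨X i, hI _ (hX i)⟩
  have hx : ∀ i, x i ∈ subGrading (weightedGrading k (1 : Fin n → ℕ)) I 1 := hX
  -- The Koszul relation X_j e_i - X_i e_j, a cycle over `I` of internal degree 2. A bounding chain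
  -- would have coefficients in degree 0 of `I`, hence be zero.
  obtain ⟨w, hw, hwz⟩ := h (pair i (pair j 0 (incl l (-x i))) (incl (j :: l) (x j)))
    (pair_mem_piece.2 ⟨pair_mem_piece.2 ⟨zero_mem _, incl_mem_piece l (neg_mem (hx i))⟩,
      incl_mem_piece _ (hx j)⟩) (by
    have h0 : smulEnd I (X : Fin n → MvPolynomial (Fin n) k) j (-x i) +
        smulEnd I (X : Fin n → MvPolynomial (Fin n) k) i (x j) = 0 := by
      apply Subtype.ext
      change X j * -X i + X i * X j = (0 : MvPolynomial (Fin n) k)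
      ring
    rw [bd_pair, bd_pair, bd_incl, bd_incl, map_zero, zero_add, map_incl, map_incl, neg_zero,
      ← incl_cons, ← map_add, h0, map_zero, neg_zero, pair_zero])
  rw [eq_zero_of_mem_piece (fun _ => rfl) _ (fun y hy => Subtype.ext (hI0 y hy y.2)) hw, map_zero,
    ← pair_zero, pair_inj] at hwz
  have h0 : x j = 0 := incl_injective (j :: l) (by rw [← hwz.2, map_zero])
  exact X_ne_zero j (congrArg Subtype.val h0)

variable {G : Type v} [Group G] {V : Type w} [AddCommGroup V] [Module k V]
  {b : Module.Basis (Fin n) k V} {ρ : Representation k G V}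

theorem intGrading_hilbertIdealPiece :
    intGrading (hilbertIdealPiece b ρ) =
      subGrading (weightedGrading k (1 : Fin n → ℕ)) (hilbertIdeal b ρ) := by
  funext m
  ext x
  rw [mem_subGrading]
  rcases lt_or_ge m 0 with hm | hm
  · rw [mem_intGrading_of_neg hm, mem_intGrading_of_neg hm]
    exact (hilbertIdeal b ρ).coe_eq_zero.symm
  · obtain ⟨m, rfl⟩ := Int.eq_ofNat_of_zero_le hm
    exact mem_intGrading_natCast.trans mem_weightedGrading_one_iff.symm

variable {r : ℕ} {f : Fin r → invariantRing b ρ} {e : Fin r → ℕ}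

/-- The bound for the second Koszul homology in terms of the one for `Tor`. -/
theorem acyclic_hilbertIdeal_one (hf : IsMinimalGenerators b ρ f e)
    (h : hilbertIdealTorEnd b ρ 1 ≤ (tau b ρ : EReal)) (d : ℤ) (hd : tau b ρ < d) :
    Acyclic (fun _ => 1) (subGrading (weightedGrading k (1 : Fin n → ℕ)) (hilbertIdeal b ρ))
      (smulEnd _ (X : Fin n → MvPolynomial (Fin n) k)) (List.finRange n) 1 d := by
  have hB : IsModuleGrading (weightedGrading k (1 : Fin n → ℕ))
      (weightedGrading k (1 : Fin n → ℕ)) :=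
    ⟨mul_mem_weightedGrading _, fun hn _ hx => (mem_intGrading_of_neg hn).1 hx⟩
  let π : GradedProj (subGrading (weightedGrading k (1 : Fin n → ℕ)) (hilbertIdeal b ρ)) :=
    (weightedProj k (1 : Fin n → ℕ)).ofInjective
      (hilbertIdeal b ρ).subtype.toAddMonoidHom Subtype.val_injective (fun _ _ => Iff.rfl)
      fun m x => by
        let P := (weightedProj k (1 : Fin n → ℕ)).free fun j => (e j : ℤ)
        obtain ⟨g, hg⟩ : ∃ g, Finsupp.linearCombination (MvPolynomial (Fin n) k)
            (fun j => (f j : MvPolynomial (Fin n) k)) g = x := by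
          exact Finsupp.mem_span_range_iff_exists_finsupp.1 (hf.hilbertIdeal_eq.le x.2)
        have hproj := P.map_proj (weightedProj k (1 : Fin n → ℕ))
          (φ := (Finsupp.linearCombination (MvPolynomial (Fin n) k)
            (fun j => (f j : MvPolynomial (Fin n) k))).toAddMonoidHom)
          (fun m g hg => hB.linearCombination_mem
            (fun j => mem_weightedGrading_one_iff.2 (hf.isHomogeneous j)) hg) m g
        refine ⟨⟨(weightedProj k (1 : Fin n → ℕ)).proj m x, ?_⟩, rfl⟩
        refine hf.hilbertIdeal_eq.ge ?_
        rw [← hg]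
        exact Finsupp.mem_span_range_iff_exists_finsupp.2 ⟨P.proj m g, hproj⟩
  obtain ⟨d, rfl⟩ := Int.eq_ofNat_of_zero_le (show 0 ≤ d by omega)
  rw [← intGrading_hilbertIdealPiece] at π ⊢
  have hM : IsModuleGrading (weightedGrading k (1 : Fin n → ℕ))
      (intGrading (hilbertIdealPiece b ρ)) := by
    rw [intGrading_hilbertIdealPiece]
    exact hB.sub _
  -- `torEnd` is a supremum over resolutions, so its bound carries information only once a
  -- resolution exists.
  obtain ⟨F⟩ := nonempty_gradedFreeResolution hM π
  exact F.acyclic_one (fun _ => one_pos) (fun j => List.mem_finRange j) (List.nodup_finRange n) π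
    fun z hz hzd => mem_boundaries_of_torEnd_le h F (by exact_mod_cast hd) hz hzd

/-- From the Koszul homology of the generators with coefficients in the polynomial ring to
`Tor` of the ring of invariants. -/
theorem invariantTorEnd_le (h : IsSplitInvariants b ρ) (hf : IsMinimalGenerators b ρ f e) {i : ℕ}
    {c : ℝ} (hc : ∀ d : ℕ, c < d → Acyclic (fun j => (e j : ℤ)) (weightedGrading k (1 : Fin n → ℕ))
      (smulEnd _ fun j => (f j : MvPolynomial (Fin n) k)) (List.finRange r) i d) :
    invariantTorEnd b ρ f e i ≤ (c : EReal) := by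
  let _ : Module (MvPolynomial (Fin r) k) (invariantRing b ρ) :=
    Module.compHom (invariantRing b ρ)
      (aeval f : MvPolynomial (Fin r) k →ₐ[k] invariantRing b ρ).toRingHom
  change torEnd (weightedHomogeneousSubmodule k e) (invariantPiece b ρ) i ≤ _
  have hsmul : ∀ (j : Fin r) (x : invariantRing b ρ),
      (X j : MvPolynomial (Fin r) k) • x = f j * x := fun j x =>
    congrArg (· * x) (aeval_X (R := k) f j)
  have hP : ∀ (m : ℤ) (x : invariantRing b ρ), x ∈ intGrading (invariantPiece b ρ) m ↔
      (x : MvPolynomial (Fin n) k) ∈ weightedGrading k (1 : Fin n → ℕ) m := by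
    intro m x
    rcases lt_or_ge m 0 with hm | hm
    · rw [mem_intGrading_of_neg hm, mem_intGrading_of_neg hm]
      exact ZeroMemClass.coe_eq_zero.symm
    · obtain ⟨m, rfl⟩ := Int.eq_ofNat_of_zero_le hm
      exact mem_intGrading_natCast.trans mem_weightedGrading_one_iff.symm
  let π : GradedProj (intGrading (invariantPiece b ρ)) :=
    (weightedProj k (1 : Fin n → ℕ)).ofInjective
      (invariantRing b ρ).val.toLinearMap.toAddMonoidHom Subtype.val_injective hP fun m x => by
        refine ⟨⟨(weightedProj k (1 : Fin n → ℕ)).proj m x, ?_⟩, rfl⟩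
        change (if 0 ≤ m then _ else _ : MvPolynomial (Fin n) k →+ _) _ ∈ _
        split_ifs
        · exact homogeneousComponent_mem_invariantRing b ρ x.2 _
        · exact zero_mem _
  obtain ⟨φ, hφ, hφr, hφ1, hφh⟩ := h.exists_graded
  refine torEnd_le fun F d hd z hz hzd => F.mem_boundaries_of_acyclic hf.degree_pos
    (fun j => List.mem_finRange j) (List.nodup_finRange r) π ?_ hzd hz
  refine (hc d hd).of_retract (invariantRing b ρ).val.toLinearMap.toAddMonoidHom
    (φ.codRestrict (Subalgebra.toSubmodule (invariantRing b ρ)) hφ).toAddMonoidHom ?_ ?_ ?_ ?_ ?_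
  · intro j x
    rw [smulEnd_apply, hsmul]
    rfl
  · intro j x
    rw [smulEnd_apply, smulEnd_apply, hsmul]
    exact Subtype.ext (hφr _ (f j).2 x)
  · exact fun m x hx => (hP m x).1 hx
  · intro m x hx
    rw [hP]
    rcases mem_intGrading_iff.1 hx with rfl | ⟨m, rfl, hx'⟩
    · rw [map_zero]
      exact zero_mem _
    · exact mem_weightedGrading_one_iff.2 (hφh m x hx')
  · intro x
    apply Subtype.ext
    have := hφr x x.2 1
    rw [hφ1, mul_one] at this
    exact this

variable [Finite G]

theorem mem_hilbertIdeal_of_tau_le (h : IsSplitInvariants b ρ) (m : ℤ) (hm : tau b ρ ≤ m)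
    (p : MvPolynomial (Fin n) k) (hp : p ∈ weightedGrading k (1 : Fin n → ℕ) m) :
    p ∈ hilbertIdeal b ρ := by
  rcases mem_intGrading_iff.1 hp with rfl | ⟨m, rfl, hpm⟩
  · exact zero_mem _
  · exact mem_hilbertIdeal_of_isHomogeneous_mul b ρ (tau_mem b ρ h).2 (by exact_mod_cast hm) hpm

/-- From bounds for the syzygies of the Hilbert ideal to bounds for the Koszul homology of the
generators of the ring of invariants, with coefficients in the polynomial ring. -/
theorem acyclic_generators (h : IsSplitInvariants b ρ) (hf : IsMinimalGenerators b ρ f e)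
    {t : ℕ → ℤ} (ht : Monotone t) (ht0 : t 0 = tau b ρ)
    (hN : ∀ (s : ℕ) (d : ℤ), t s < d → Acyclic (fun _ => 1)
      (subGrading (weightedGrading k (1 : Fin n → ℕ)) (hilbertIdeal b ρ))
      (smulEnd _ (X : Fin n → MvPolynomial (Fin n) k)) (List.finRange n) s d)
    {β : ℕ → ℤ} (hβ : ∀ q : ℕ, (q + 1) * (tau b ρ : ℤ) ≤ β q)
    (hβt : ∀ p q, p < q → β p + t (q - p) ≤ β q) (q : ℕ) (d : ℤ) (hd : β q ≤ d) :
    Acyclic (fun j => (e j : ℤ)) (weightedGrading k (1 : Fin n → ℕ))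
      (smulEnd _ fun j => (f j : MvPolynomial (Fin n) k)) (List.finRange r) q d :=
  acyclic_of_ideal (I := hilbertIdeal b ρ) (x := (X : Fin n → MvPolynomial (Fin n) k))
    (e := fun _ => 1) (l := List.finRange n) (isRingGrading_weightedGrading (1 : Fin n → ℕ))
    (X_mem_weightedGrading (1 : Fin n → ℕ)) (fun _ => one_pos)
    (fun _ hp d => acyclic_X_of_pos (1 : Fin n → ℕ) (List.nodup_finRange n) hp d)
    (fun _ hd => acyclic_X_zero (1 : Fin n → ℕ) (fun j => List.mem_finRange j) hd)
    (fun j => mem_weightedGrading_one_iff.2 (hf.isHomogeneous j)) (fun j => List.mem_finRange j)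
    (fun _ => Int.natCast_nonneg _)
    (fun j => Ideal.subset_span ⟨(f j).2, e j, hf.degree_pos j, hf.isHomogeneous j⟩)
    hf.exists_linearCombination_eq (mem_hilbertIdeal_of_tau_le h)
    (fun j => by exact_mod_cast hf.degree_le_tau h j) ht ht0 hN hβ hβt q d hd

end Main

end

theorem theorem1p2 {k : Type u} [Field k] {G : Type v} [Group G] [Finite G]
    {V : Type w} [AddCommGroup V] [Module k V] {n : ℕ} (b : Module.Basis (Fin n) k V)
    (ρ : Representation k G V)
    (hsplit : (Nat.card G : k) ≠ 0 ∨ IsSplitInvariants b ρ)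
    {r : ℕ} (f : Fin r → invariantRing b ρ) (e : Fin r → ℕ)
    (hf : IsMinimalGenerators b ρ f e) (i : ℕ) :
    (invariantTorEnd b ρ f e i ≤ ((((i : ℝ) + 1) * (tau b ρ : ℝ) + i - 1 : ℝ) : EReal) ∧
      ((i : ℝ) + 1) * (tau b ρ : ℝ) + i - 1 ≤ ((i : ℝ) + 1) * (Nat.card G : ℝ) + i - 1) ∧
    (hilbertIdealTorEnd b ρ 1 ≤ (tau b ρ : EReal) →
      invariantTorEnd b ρ f e i ≤ ((((i : ℝ) + 1) * (tau b ρ : ℝ) - 1 : ℝ) : EReal) ∧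
      ((i : ℝ) + 1) * (tau b ρ : ℝ) - 1 ≤ ((i : ℝ) + 1) * (Nat.card G : ℝ) - 1) := by
  have h : IsSplitInvariants b ρ :=
    hsplit.elim (isSplitInvariants_of_card_ne_zero b ρ) id
  have hle : ((i : ℝ) + 1) * (tau b ρ : ℝ) ≤ ((i : ℝ) + 1) * (Nat.card G : ℝ) := by
    have := tau_le_card b ρ h
    gcongr
  have hτ0 : 0 < tau b ρ := (tau_mem b ρ h).1
  have hacyc := acyclic_ideal_of_forall_mem (Int.natCast_nonneg _)
    (mem_hilbertIdeal_of_tau_le h)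
  refine ⟨⟨invariantTorEnd_le h hf fun d hd => ?_, by linarith⟩,
    fun h1 => ⟨invariantTorEnd_le h hf fun d hd => ?_, by linarith⟩⟩
  -- With t_s = τ + s, the condition on β reads (p+2)τ + q ≤ (q+1)τ + q, which holds for p < q.
  · refine acyclic_generators h hf (t := fun s => (tau b ρ : ℤ) + s)
      (fun s s' hs => by dsimp only; omega) (by simp) hacyc
      (β := fun q => (q + 1) * (tau b ρ : ℤ) + q) (fun q => by omega) ?_ i d ?_
    · intro p q hpq
      rw [Nat.cast_sub hpq.le]
      nlinarith
    · have hd' : ((i : ℝ) + 1) * (tau b ρ : ℝ) + i < d + 1 := by linarith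
      have : ((i : ℤ) + 1) * (tau b ρ : ℤ) + i < d + 1 := by exact_mod_cast hd'
      omega
  · have hdβ : ((i : ℤ) + 1) * (tau b ρ : ℤ) ≤ d := by
      have hd' : ((i : ℝ) + 1) * (tau b ρ : ℝ) < d + 1 := by linarith
      have : ((i : ℤ) + 1) * (tau b ρ : ℤ) < d + 1 := by exact_mod_cast hd'
      omega
    have hone := acyclic_hilbertIdeal_one hf h1
    rcases Nat.lt_or_ge 1 (tau b ρ) with hτ | hτ
    -- The hypothesis improves only t_1. For s = q - p ≥ 2 the condition is τ + s ≤ sτ, which the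
    -- general bound satisfies because τ ≥ 2.
    · refine acyclic_generators h hf (t := fun s => if s ≤ 1 then (tau b ρ : ℤ) else tau b ρ + s)
        (fun s s' hs => ?_) (by simp) ?_
        (β := fun q => (q + 1) * (tau b ρ : ℤ)) (fun q => le_rfl) ?_ i d hdβ
      · dsimp only
        split_ifs <;> omega
      · intro s d hd
        split_ifs at hd with hs
        · interval_cases s
          · exact hacyc 0 d (by simpa using hd)
          · exact hone d hd
        · exact hacyc s d hd
      · intro p q hpq
        obtain ⟨s, rfl⟩ := Nat.exists_eq_add_of_lt hpq
        rw [show p + s + 1 - p = s + 1 by omega]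
        split_ifs with hs
        · have : s = 0 := by omega
          subst this
          push_cast
          linarith
        · push_cast
          have h2 : (1 : ℤ) ≤ s := by omega
          have h3 : (2 : ℤ) ≤ tau b ρ := by exact_mod_cast hτ
          nlinarith
    -- For τ = 1 the general bound τ + s is too weak. But `I` is then the ideal of the variables,
    -- whose Koszul relations have degree 2 > τ, so there is at most one variable.
    · have hτ1 : tau b ρ = 1 := le_antisymm hτ hτ0
      have hn : n ≤ 1 := by
        refine le_one_of_acyclic_one (I := hilbertIdeal b ρ)
          (fun p hp => mem_hilbertIdeal_of_tau_le h 1 (by rw [hτ1]; rfl) p hp) ?_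
          (hone 2 (by rw [hτ1]; norm_num))
        intro p hp hpI
        obtain ⟨g, hg, rfl⟩ := hf.exists_linearCombination_eq 0 p hp hpI
        have hg0 : g = 0 := by
          ext1 j
          refine (mem_intGrading_of_neg ?_).1 (hg j)
          have := hf.degree_pos j
          simpa using this
        rw [hg0, map_zero]
      refine acyclic_generators h hf (t := fun _ => (tau b ρ : ℤ)) (fun s s' hs => le_rfl) rfl ?_
        (β := fun q => (q + 1) * (tau b ρ : ℤ)) (fun q => le_rfl) ?_ i d hdβ
      · intro s d hd
        rcases Nat.lt_or_ge s 2 with hs | hs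
        · interval_cases s
          · exact hacyc 0 d (by simpa using hd)
          · exact hone d hd
        -- The Koszul complex of at most one variable has nothing in homological degree 2 and above,
        -- so the constant bound τ holds for all `s`.
        · exact Koszul.acyclic_of_length_lt (by rw [List.length_finRange]; omega)
      · intro p q hpq
        rw [hτ1]
        push_cast
        omega
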